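/- Let $(\Omega,\Sigma)$ be a measurable space and $\mathcal H$ a complex Hilbert space. A POVM $M:\Sigma\to\mathcal L(\mathcal H)$ is a map with $M(X)\ge 0$ for all $X\in\Sigma$, $M(\Omega)=I_{\mathcal H}$, and $M(\bigcup_j X_j)=\sum_j M(X_j)$ weakly for every pairwise disjoint sequence $(X_j)$ in $\Sigma$; it is a PVM if every $M(X)$ is an orthogonal projection. Two POVMs $M,N$ on $\Sigma$, acting on possibly different Hilbert spaces, are equivalent, $M\sim N$, if for all $X\in\Sigma$ one has $M(X)=0$ exactly when $N(X)=0$. A channel is a completely positive, normal, unital linear map $\Phi:\mathcal L(\mathcal H)\to\mathcal L(\mathcal H')$, where normal means that it preserves suprema of bounded increasing nets of self-adjoint operators. For POVMs $M:\Sigma\to\mathcal L(\mathcal H)$ and $M':\Sigma\to\mathcal L(\mathcal H')$ write $M'\le_{\rm pre}M$ if there is a channel $\Phi:\mathcal L(\mathcal H)\to\mathcal L(\mathcal H')$ with $M'(X)=\Phi(M(X))$ for all $X\in\Sigma$. A POVM $M$ is pre-processing clean if, for every Hilbert space $\mathcal H'$ and every POVM $M':\Sigma\to\mathcal L(\mathcal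 H')$ such that $M'\sim M$ and $M\le_{\rm pre}M'$, one has $M'\le_{\rm pre}M$. Theorem. Suppose that $\Sigma$ is countably generated, $\mathcal H$ is a separable Hilbert space and $M:\Sigma\to\mathcal L(\mathcal H)$ is a POVM. Then $M$ is pre-processing clean if and only if there exist a closed subspace $\mathcal M\subseteq\mathcal H$, a PVM $E:\Sigma\to\mathcal L(\mathcal M)$, and a POVM $F:\Sigma\to\mathcal L(\mathcal M^\perp)$ such that $M\sim E$ and $$M(X)=E(X)\oplus F(X),\qquad X\in\Sigma,$$ with respect to the decomposition $\mathcal H=\mathcal M\oplus\mathcal M^\perp$. -/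

import Mathlib

open scoped InnerProductSpace CStarAlgebra

universe u v w

/-- A normalized positive-operator-valued measure (an observable) on the measurable space `Ω`
with values in the bounded operators on the Hilbert space `H`; positivity refers to the Loewner
order. It is a function on the σ-algebra, extended by `0` to nonmeasurable sets. -/
structure POVM (Ω : Type v) [MeasurableSpace Ω] (H : Type u) [NormedAddCommGroup H]
    [InnerProductSpace ℂ H] [CompleteSpace H] where
  /-- the operator assigned to a set -/
  op : Set Ω → (H →L[ℂ] H)
  op_not_measurable : ∀ X : Set Ω, ¬ MeasurableSet X → op X = 0
  op_nonneg : ∀ X : Set Ω, MeasurableSet X → 0 ≤ op X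
  op_univ : op Set.univ = 1
  /-- σ-additivity in the weak operator topology -/
  op_iUnion : ∀ X : ℕ → Set Ω, (∀ j, MeasurableSet (X j)) →
    Pairwise (fun i j => Disjoint (X i) (X j)) →
    ∀ φ ψ : H, HasSum (fun j => ⟪φ, op (X j) ψ⟫_ℂ) ⟪φ, op (⋃ j, X j) ψ⟫_ℂ

/-- A completely positive linear map `Φ : L(K) → L(H)` is a (Heisenberg) channel if it is unital
and normal, i.e. it preserves suprema of increasing nets of self-adjoint operators. -/
structure IsChannel {K : Type u} [NormedAddCommGroup K] [InnerProductSpace ℂ K] [CompleteSpace K]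
    {H : Type w} [NormedAddCommGroup H] [InnerProductSpace ℂ H] [CompleteSpace H]
    (Φ : (K →L[ℂ] K) →CP (H →L[ℂ] H)) : Prop where
  unital : Φ 1 = 1
  normal : ∀ S : Set (K →L[ℂ] K), S.Nonempty → (∀ a ∈ S, IsSelfAdjoint a) →
    DirectedOn (· ≤ ·) S → ∀ a : K →L[ℂ] K, IsLUB S a → IsLUB (Φ '' S) (Φ a)

namespace POVM

variable {Ω : Type v} [MeasurableSpace Ω]
  {H : Type u} [NormedAddCommGroup H] [InnerProductSpace ℂ H] [CompleteSpace H]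
  {H' : Type w} [NormedAddCommGroup H'] [InnerProductSpace ℂ H'] [CompleteSpace H']

/-- A POVM is a PVM (a sharp observable) if all its values are orthogonal projections. -/
def IsPVM (M : POVM Ω H) : Prop :=
  ∀ X : Set Ω, MeasurableSet X → IsStarProjection (M.op X)

/-- Absolute continuity `M ≪ N`. -/
def AbsCont (M : POVM Ω H) (N : POVM Ω H') : Prop :=
  ∀ X : Set Ω, MeasurableSet X → N.op X = 0 → M.op X = 0

/-- Equivalence `M ∼ N` of POVMs, possibly on different Hilbert spaces: they have the same
null sets. -/
def Equivalent (M : POVM Ω H) (N : POVM Ω H') : Prop :=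
  M.AbsCont N ∧ N.AbsCont M

/-- `M' ≤_pre M`: the POVM `M'` is a pre-processing of `M`, i.e. `M'(X) = Φ(M(X))` for all
measurable `X`, for some channel `Φ : L(H) → L(H')`. -/
def PreLE (M' : POVM Ω H') (M : POVM Ω H) : Prop :=
  ∃ Φ : (H →L[ℂ] H) →CP (H' →L[ℂ] H'), IsChannel Φ ∧
    ∀ X : Set Ω, MeasurableSet X → M'.op X = Φ (M.op X)

/-- `M` is pre-processing clean (pre-processing maximal): every POVM `M'`, on any Hilbert space
(in the universe `w`), that is equivalent to `M` and has `M` as a pre-processing is itself a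
pre-processing of `M`. -/
def IsPreProcessingClean (M : POVM Ω H) : Prop :=
  ∀ (H' : Type w) [NormedAddCommGroup H'] [InnerProductSpace ℂ H'] [CompleteSpace H']
    (M' : POVM Ω H'), M'.Equivalent M → M.PreLE M' → M'.PreLE M

end POVM

/-- The orthogonal direct sum `A ⊕ B` of an operator on a complete subspace `𝓜` and an operator
on its orthogonal complement, as an operator on the whole space. -/
noncomputable def orthogonalSum {H : Type u} [NormedAddCommGroup H] [InnerProductSpace ℂ H]
    [CompleteSpace H] (𝓜 : Submodule ℂ H) [CompleteSpace 𝓜]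
    (A : 𝓜 →L[ℂ] 𝓜) (B : 𝓜ᗮ →L[ℂ] 𝓜ᗮ) : H →L[ℂ] H :=
  𝓜.subtypeL ∘L A ∘L 𝓜.orthogonalProjectionOnto + 𝓜ᗮ.subtypeL ∘L B ∘L 𝓜ᗮ.orthogonalProjectionOnto

section

open scoped ComplexOrder
open Filter Topology

/-! Both directions rest on a Radon–Nikodym type fact, `exists_hasSum_of_absCont`: if `E` is sharp
on a separable space and `M ≪ E`, then `M(X) = ∑ V* E(X) V` weakly for some family of operators `V`,
so `M` is a pre-processing of `E`. To see this, take a maximal family with `∑ V* E V ≤ M`. If the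
remainder `N` is nonzero, some scalar measure `⟨φ, Nφ⟩` is not singular to some `⟨ψ, Eψ⟩`. On a
suitable set `Y` the former is then bounded by a multiple of the latter, so `E(Z)ψ ↦ N(Z ∩ Y)φ`
extends to a bounded operator whose adjoint `V` satisfies `V* E V ≤ c N`. This contradicts
maximality.

If `M = E ⊕ F` with `M ∼ E` and `M' ∼ M`, then `M' ≪ E`. Composing the operators `V` for `M'` with
the inclusion of `𝓜` makes `M'` a pre-processing of `M`.

Conversely, let `M` be clean. Choose a finite measure `μ` with the null sets of `M`; multiplication
by indicators on `L²(μ)` is a sharp `E ∼ M`. Hence `M` is a pre-processing of `E`, and cleanness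
yields a channel with `E = Φ(M)`. The Schwarz inequality gives `Φ(M(Z) - M(Z)²) ≤ E(Z) - E(Z)² = 0`,
so by normality `Φ` only sees the joint kernel of these defects
(`IsChannel.map_eq_zero_of_forall_apply_eq_zero`). This kernel is invariant under `M`, and `M` is
sharp on it. If `M(X)` vanishes there, then `E(X) = Φ(M(X)) = 0`, hence `M(X) = 0`. So the sharp
part is equivalent to `M`. -/

theorem inner_self_nonneg_complex {H : Type*} [NormedAddCommGroup H] [InnerProductSpace ℂ H]
    (x : H) : 0 ≤ ⟪x, x⟫_ℂ :=
  Complex.nonneg_iff.2 ⟨inner_self_nonneg (𝕜 := ℂ), (inner_self_im (𝕜 := ℂ) x).symm⟩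

/-! ### Positive operators, weak limits and operator matrices. -/

section Operators

variable {H : Type*} [NormedAddCommGroup H] [InnerProductSpace ℂ H] [CompleteSpace H]

namespace ContinuousLinearMap

theorem nonneg_iff_inner {A : H →L[ℂ] H} : 0 ≤ A ↔ ∀ x, 0 ≤ ⟪x, A x⟫_ℂ := by
  rw [nonneg_iff_isPositive]
  refine ⟨fun h x => h.inner_nonneg_right x, fun h => ?_⟩
  rw [isPositive_iff_complex]
  intro x
  have hx : (0 : ℂ) ≤ ⟪A x, x⟫_ℂ := by
    rw [← inner_conj_symm, (Complex.conj_eq_iff_im.2 (Complex.nonneg_iff.1 (h x)).2.symm)]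
    exact h x
  obtain ⟨h1, h2⟩ := Complex.nonneg_iff.1 hx
  exact ⟨Complex.ext (by simp) (by simp [← h2]), h1⟩

theorem le_iff_inner {A B : H →L[ℂ] H} : A ≤ B ↔ ∀ x, ⟪x, A x⟫_ℂ ≤ ⟪x, B x⟫_ℂ := by
  rw [← sub_nonneg, nonneg_iff_inner]
  simp

theorem re_inner_nonneg_of_nonneg {A : H →L[ℂ] H} (hA : 0 ≤ A) (x : H) : 0 ≤ (⟪x, A x⟫_ℂ).re :=
  (Complex.nonneg_iff.1 (nonneg_iff_inner.1 hA x)).1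

theorem re_inner_mono {A B : H →L[ℂ] H} (h : A ≤ B) (x : H) :
    (⟪x, A x⟫_ℂ).re ≤ (⟪x, B x⟫_ℂ).re :=
  (Complex.le_def.1 (le_iff_inner.1 h x)).1

theorem inner_eq_ofReal_re {A : H →L[ℂ] H} (hA : 0 ≤ A) (x : H) :
    ⟪x, A x⟫_ℂ = ((⟪x, A x⟫_ℂ).re : ℂ) :=
  Complex.ext (by simp) (by simpa using (Complex.nonneg_iff.1 (nonneg_iff_inner.1 hA x)).2.symm)

/-- The Cauchy–Schwarz inequality for the form of a positive operator. -/
theorem norm_inner_sq_le_of_nonneg {A : H →L[ℂ] H} (hA : 0 ≤ A) (x y : H) :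
    ‖⟪x, A y⟫_ℂ‖ ^ 2 ≤ (⟪x, A x⟫_ℂ).re * (⟪y, A y⟫_ℂ).re := by
  obtain ⟨B, rfl⟩ := CStarAlgebra.nonneg_iff_eq_star_mul_self.1 hA
  have key : ∀ x y : H, ⟪x, (star B * B) y⟫_ℂ = ⟪B x, B y⟫_ℂ := fun x y => by
    rw [star_eq_adjoint, mul_apply_eq_comp, adjoint_inner_right]
  rw [key, key, key]
  have h := norm_inner_le_norm (𝕜 := ℂ) (B x) (B y)
  have h1 : (⟪B x, B x⟫_ℂ).re = ‖B x‖ ^ 2 := by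
    rw [inner_self_eq_norm_sq_to_K]; norm_cast
  have h2 : (⟪B y, B y⟫_ℂ).re = ‖B y‖ ^ 2 := by
    rw [inner_self_eq_norm_sq_to_K]; norm_cast
  rw [h1, h2, ← mul_pow]
  gcongr

theorem apply_eq_zero_of_inner_eq_zero {A : H →L[ℂ] H} (hA : 0 ≤ A) {x : H}
    (h : ⟪x, A x⟫_ℂ = 0) : A x = 0 := by
  have := norm_inner_sq_le_of_nonneg hA (A x) x
  rw [h] at this
  simp only [Complex.zero_re, mul_zero] at this
  have h0 : ‖⟪A x, A x⟫_ℂ‖ = 0 := by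
    have := norm_nonneg ⟪A x, A x⟫_ℂ
    nlinarith
  simpa using h0

theorem eq_zero_of_inner_eq_zero {A : H →L[ℂ] H} (hA : 0 ≤ A) (h : ∀ x, ⟪x, A x⟫_ℂ = 0) :
    A = 0 :=
  ext fun x => by simpa using apply_eq_zero_of_inner_eq_zero hA (h x)

/-- A bounded net of operators whose matrix elements converge has a limit in the weak operator
topology. -/
theorem exists_forall_tendsto_inner {ι : Type*} {F : Filter ι} [F.NeBot]
    (A : ι → H →L[ℂ] H) {C : ℝ} (hC : ∀ᶠ i in F, ‖A i‖ ≤ C)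
    (h : ∀ x y : H, ∃ l : ℂ, Tendsto (fun i => ⟪x, A i y⟫_ℂ) F (𝓝 l)) :
    ∃ B : H →L[ℂ] H, ∀ x y : H, Tendsto (fun i => ⟪x, A i y⟫_ℂ) F (𝓝 ⟪x, B y⟫_ℂ) := by
  choose l hl using h
  have hbd : ∀ x y, ‖l x y‖ ≤ C * ‖x‖ * ‖y‖ := fun x y => by
    refine le_of_tendsto (hl x y).norm ?_
    filter_upwards [hC] with i hi
    calc ‖⟪x, A i y⟫_ℂ‖ ≤ ‖x‖ * ‖A i y‖ := norm_inner_le_norm _ _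
      _ ≤ ‖x‖ * (C * ‖y‖) := by gcongr; exact (A i).le_of_opNorm_le hi y
      _ = C * ‖x‖ * ‖y‖ := by ring
  -- The limits form a bounded sesquilinear form, by uniqueness of limits.
  let L : H →ₗ⋆[ℂ] H →ₗ[ℂ] ℂ := LinearMap.mk₂'ₛₗ (starRingEnd ℂ) (RingHom.id ℂ) l
    (fun x x' y => tendsto_nhds_unique (hl _ _)
      (((hl x y).add (hl x' y)).congr fun i => (inner_add_left _ _ _).symm))
    (fun c x y => tendsto_nhds_unique (hl _ _)
      (((hl x y).const_mul (starRingEnd ℂ c)).congr fun i => (inner_smul_left _ _ _).symm))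
    (fun x y y' => tendsto_nhds_unique (hl _ _)
      (((hl x y).add (hl x y')).congr fun i => by rw [map_add, inner_add_right]))
    (fun c x y => tendsto_nhds_unique (hl _ _)
      (((hl x y).const_mul c).congr fun i => by rw [map_smul, inner_smul_right]))
  -- This operator represents the form as `⟪B x, y⟫`; the adjoint moves it to the right slot.
  let B := InnerProductSpace.continuousLinearMapOfBilin (L.mkContinuous₂ C hbd)
  refine ⟨adjoint B, fun x y => ?_⟩
  have : ⟪x, adjoint B y⟫_ℂ = l x y := by
    rw [adjoint_inner_right]
    exact InnerProductSpace.continuousLinearMapOfBilin_apply _ x y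
  rw [this]
  exact hl x y

/-- A bounded family of operators converges in the weak operator topology along an ultrafilter. -/
theorem exists_forall_tendsto_inner_ultrafilter {ι : Type*} (F : Ultrafilter ι)
    (A : ι → H →L[ℂ] H) {C : ℝ} (hC : ∀ᶠ i in F, ‖A i‖ ≤ C) :
    ∃ B : H →L[ℂ] H, ∀ x y : H, Tendsto (fun i => ⟪x, A i y⟫_ℂ) F (𝓝 ⟪x, B y⟫_ℂ) := by
  refine exists_forall_tendsto_inner A hC fun x y => ?_
  have hK : IsCompact (Metric.closedBall (0 : ℂ) (C * ‖x‖ * ‖y‖)) := isCompact_closedBall _ _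
  obtain ⟨l, -, hl⟩ := isCompact_iff_ultrafilter_le_nhds.1 hK (F.map fun i => ⟪x, A i y⟫_ℂ) (by
    simp only [Ultrafilter.coe_map, le_principal_iff, mem_map]
    filter_upwards [hC] with i hi
    simp only [Set.mem_preimage, mem_closedBall_zero_iff]
    calc ‖⟪x, A i y⟫_ℂ‖ ≤ ‖x‖ * ‖A i y‖ := norm_inner_le_norm _ _
      _ ≤ ‖x‖ * (C * ‖y‖) := by gcongr; exact (A i).le_of_opNorm_le hi y
      _ = C * ‖x‖ * ‖y‖ := by ring)
  exact ⟨l, hl⟩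

/-- A nonempty directed set of operators that is bounded above has a supremum, and the supremum is a
limit of the set in the weak operator topology. -/
theorem exists_isLUB_tendsto_inner {S : Set (H →L[ℂ] H)} (hne : S.Nonempty)
    (hdir : DirectedOn (· ≤ ·) S) (hbdd : BddAbove S) :
    ∃ a : H →L[ℂ] H, IsLUB S a ∧ ∃ F : Filter S, F.NeBot ∧ (∃ C, ∀ᶠ s : S in F, ‖(s : H →L[ℂ] H)‖ ≤ C) ∧
      ∀ x y : H, Tendsto (fun s : S => ⟪x, (s : H →L[ℂ] H) y⟫_ℂ) F (𝓝 ⟪x, a y⟫_ℂ) := by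
  obtain ⟨s₀, hs₀⟩ := hne
  obtain ⟨b, hb⟩ := hbdd
  have : Nonempty S := ⟨⟨s₀, hs₀⟩⟩
  have : IsDirectedOrder S := ⟨fun s t => by
    obtain ⟨r, hr, h1, h2⟩ := hdir s s.2 t t.2
    exact ⟨⟨r, hr⟩, h1, h2⟩⟩
  -- Along an ultrafilter finer than `atTop`, weak compactness alone gives a limit. Norms are only
  -- controlled past `s₀`, hence the eventual bound.
  let F : Ultrafilter S := Ultrafilter.of atTop
  have hF : ∀ t : S, ∀ᶠ s in (F : Filter S), t ≤ s := fun t =>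
    Ultrafilter.of_le atTop (mem_atTop t)
  have hC : ∀ᶠ s : S in (F : Filter S), ‖(s : H →L[ℂ] H)‖ ≤ ‖s₀‖ + ‖b - s₀‖ := by
    filter_upwards [hF ⟨s₀, hs₀⟩] with s hs
    have h1 : 0 ≤ (s : H →L[ℂ] H) - s₀ := sub_nonneg.2 hs
    have h2 : (s : H →L[ℂ] H) - s₀ ≤ b - s₀ := sub_le_sub_right (hb s.2) _
    calc ‖(s : H →L[ℂ] H)‖ = ‖s₀ + ((s : H →L[ℂ] H) - s₀)‖ := by rw [add_sub_cancel]
      _ ≤ ‖s₀‖ + ‖(s : H →L[ℂ] H) - s₀‖ := norm_add_le _ _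
      _ ≤ _ := by gcongr; exact CStarAlgebra.norm_le_norm_of_nonneg_of_le h1 h2
  obtain ⟨a, ha⟩ := exists_forall_tendsto_inner_ultrafilter F (fun s : S => (s : H →L[ℂ] H)) hC
  refine ⟨a, ⟨fun s hs => ?_, fun c hc => ?_⟩, F, inferInstance, ⟨_, hC⟩, ha⟩
  · refine le_iff_inner.2 fun x => ge_of_tendsto (ha x x) ?_
    filter_upwards [hF ⟨s, hs⟩] with t ht
    exact le_iff_inner.1 ht x
  · exact le_iff_inner.2 fun x => le_of_tendsto (ha x x) <| Eventually.of_forall fun t =>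
      le_iff_inner.1 (hc t.2) x

end ContinuousLinearMap

namespace CStarMatrix

variable {n : Type*} [Fintype n]

/-- The action of a matrix of operators on tuples of vectors. -/
noncomputable def toVecFun (x : CStarMatrix n n (H →L[ℂ] H)) (ξ : n → H) : n → H :=
  fun i => ∑ j, x i j (ξ j)

theorem toVecFun_mul (x y : CStarMatrix n n (H →L[ℂ] H)) (ξ : n → H) :
    (x * y).toVecFun ξ = x.toVecFun (y.toVecFun ξ) := by
  ext i
  simp only [toVecFun, CStarMatrix.mul_apply, sum_apply, map_sum]
  rw [Finset.sum_comm]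
  rfl

theorem sum_inner_toVecFun_star (x : CStarMatrix n n (H →L[ℂ] H)) (ξ η : n → H) :
    ∑ i, ⟪ξ i, (star x).toVecFun η i⟫_ℂ = ∑ i, ⟪x.toVecFun ξ i, η i⟫_ℂ := by
  simp only [toVecFun, CStarMatrix.star_apply, sum_inner, inner_sum,
    ContinuousLinearMap.star_eq_adjoint, ContinuousLinearMap.adjoint_inner_right]
  rw [Finset.sum_comm]

theorem eq_zero_of_toVecFun_eq_zero {x : CStarMatrix n n (H →L[ℂ] H)}
    (h : ∀ ξ, x.toVecFun ξ = 0) : x = 0 := by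
  classical
  refine CStarMatrix.ext fun i j => ContinuousLinearMap.ext fun η => ?_
  have := congrFun (h (Pi.single j η)) i
  rw [toVecFun, Finset.sum_eq_single j] at this
  · simpa using this
  · intro k _ hk
    simp [hk]
  · simp

/-- Polarization over `ℂ`, applied to the operator that `x` induces on the `ℓ²` sum of `n` copies of
`H`. -/
theorem eq_zero_of_sum_inner_eq_zero {x : CStarMatrix n n (H →L[ℂ] H)}
    (h : ∀ ξ : n → H, ∑ i, ⟪ξ i, x.toVecFun ξ i⟫_ℂ = 0) : x = 0 := by
  refine eq_zero_of_toVecFun_eq_zero fun ξ => ?_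
  let T : PiLp 2 (fun _ : n => H) →ₗ[ℂ] PiLp 2 (fun _ : n => H) :=
    { toFun := fun ξ => WithLp.toLp 2 (x.toVecFun ξ)
      map_add' := fun ξ η => by
        ext i; simp [toVecFun, Finset.sum_add_distrib]
      map_smul' := fun c ξ => by
        ext i; simp [toVecFun, Finset.smul_sum] }
  have hT : T = 0 := by
    rw [← inner_map_self_eq_zero]
    intro ξ
    rw [← inner_conj_symm, PiLp.inner_apply, map_eq_zero]
    exact h ξ
  have := congrArg (fun f : PiLp 2 (fun _ : n => H) →ₗ[ℂ] PiLp 2 (fun _ : n => H) =>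
    (f (WithLp.toLp 2 ξ)).ofLp) hT
  exact this

end CStarMatrix

/-- If a self-adjoint element of a C⋆-algebra is not positive, then it can be compressed to a
nonzero negative element. -/
theorem IsSelfAdjoint.exists_star_mul_mul_eq_neg {A : Type*} [NonUnitalCStarAlgebra A]
    [PartialOrder A] [StarOrderedRing A] {x : A} (hx : IsSelfAdjoint x) :
    ∃ c d : A, star c * x * c = -(star d * d) ∧ (d = 0 → 0 ≤ x) := by
  have hp := CFC.negPart_nonneg x
  have hps : star x⁻ = x⁻ := (IsSelfAdjoint.of_nonneg hp)
  obtain ⟨q, hq⟩ := CStarAlgebra.nonneg_iff_eq_star_mul_self.1 hp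
  have hx2 : x * x⁻ = -(x⁻ * x⁻) := by
    nth_rewrite 1 [← CFC.posPart_sub_negPart x hx]
    rw [sub_mul, CFC.posPart_mul_negPart, zero_sub]
  have e : star (q * x⁻) * (q * x⁻) = x⁻ * x⁻ * x⁻ := by
    rw [star_mul, hps, mul_assoc, ← mul_assoc (star q), ← hq, mul_assoc]
  -- Compressing by the negative part gives `x⁻ x x⁻ = -(x⁻)³`; if this vanishes, so does `x⁻`.
  refine ⟨x⁻, q * x⁻, ?_, fun h => ?_⟩
  · rw [e, hps, mul_assoc, hx2, mul_neg, mul_assoc]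
  · rw [h, mul_zero] at e
    have h1 : x⁻ * x⁻ = 0 := by
      rw [← CStarRing.star_mul_self_eq_zero_iff, star_mul, hps, ← mul_assoc, ← e, zero_mul]
    have h2 : x⁻ = 0 := by
      rw [← CStarRing.star_mul_self_eq_zero_iff, hps, h1]
    rw [← CFC.posPart_sub_negPart x hx, h2, sub_zero]
    exact CFC.posPart_nonneg x

theorem CStarAlgebra.exists_eq_star_mul_self {A : Type*} [NonUnitalCStarAlgebra A]
    [PartialOrder A] [StarOrderedRing A] {x : A} (hx : 0 ≤ x) : ∃ y, x = star y * y :=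
  CStarAlgebra.nonneg_iff_eq_star_mul_self.1 hx

/-- Positivity of a matrix of operators in terms of inner products. -/
theorem CStarMatrix.nonneg_iff_inner {n : Type*} [Fintype n]
    {x : CStarMatrix n n (H →L[ℂ] H)} :
    0 ≤ x ↔ ∀ ξ : n → H, 0 ≤ ∑ i, ∑ j, ⟪ξ i, x i j (ξ j)⟫_ℂ := by
  have hvec : ∀ (x : CStarMatrix n n (H →L[ℂ] H)) (ξ : n → H),
      ∑ i, ∑ j, ⟪ξ i, x i j (ξ j)⟫_ℂ = ∑ i, ⟪ξ i, x.toVecFun ξ i⟫_ℂ := fun x ξ => by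
    simp only [toVecFun, inner_sum]
  have hpos : ∀ ξ : n → H, 0 ≤ ∑ i, ⟪ξ i, ξ i⟫_ℂ := fun ξ => Finset.sum_nonneg fun i _ =>
    inner_self_nonneg_complex _
  simp only [hvec]
  constructor
  · intro hx ξ
    obtain ⟨y, rfl⟩ := CStarAlgebra.exists_eq_star_mul_self hx
    rw [toVecFun_mul, sum_inner_toVecFun_star]
    exact hpos _
  · intro h
    have hsa : IsSelfAdjoint x := by
      refine (sub_eq_zero.1 (eq_zero_of_sum_inner_eq_zero fun ξ => ?_))
      have h1 : ∀ i, (star x - x).toVecFun ξ i = (star x).toVecFun ξ i - x.toVecFun ξ i :=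
        fun i => by simp [toVecFun]
      simp only [h1, inner_sub_right, Finset.sum_sub_distrib, sum_inner_toVecFun_star]
      have h2 := (Complex.nonneg_iff.1 (h ξ)).2
      have h3 : ∑ i, ⟪x.toVecFun ξ i, ξ i⟫_ℂ =
          (starRingEnd ℂ) (∑ i, ⟪ξ i, x.toVecFun ξ i⟫_ℂ) := by
        simp
      rw [h3, sub_eq_zero, Complex.conj_eq_iff_im]
      exact h2.symm
    -- The form of `star c * x * c` is nonnegative by hypothesis and that of `-(star d * d)` is
    -- nonpositive, so `d = 0`.
    obtain ⟨c, d, hcd, hd⟩ := hsa.exists_star_mul_mul_eq_neg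
    refine hd (eq_zero_of_toVecFun_eq_zero fun ξ => ?_)
    have h1 : ∑ i, ⟪ξ i, (star c * x * c).toVecFun ξ i⟫_ℂ =
        ∑ i, ⟪c.toVecFun ξ i, x.toVecFun (c.toVecFun ξ) i⟫_ℂ := by
      rw [mul_assoc, toVecFun_mul, sum_inner_toVecFun_star, toVecFun_mul]
    have h2 : ∑ i, ⟪ξ i, (-(star d * d)).toVecFun ξ i⟫_ℂ =
        - ∑ i, ⟪d.toVecFun ξ i, d.toVecFun ξ i⟫_ℂ := by
      rw [← sum_inner_toVecFun_star, ← toVecFun_mul]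
      simp [toVecFun, inner_sum]
    rw [hcd, h2] at h1
    have h3 : ∑ i, ⟪d.toVecFun ξ i, d.toVecFun ξ i⟫_ℂ = 0 :=
      le_antisymm (neg_nonneg.1 (h1 ▸ h _)) (hpos _)
    rw [Finset.sum_eq_zero_iff_of_nonneg (fun i _ =>
      inner_self_nonneg_complex _)] at h3
    ext i
    simpa using h3 i (Finset.mem_univ _)

end Operators

/-! ### Channels given by Kraus operators. -/

section Kraus

open ContinuousLinearMap

variable {ι : Type*} {K : Type*} [NormedAddCommGroup K] [InnerProductSpace ℂ K] [CompleteSpace K]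
  {H : Type*} [NormedAddCommGroup H] [InnerProductSpace ℂ H] [CompleteSpace H]

/-- A completely positive map built from a row contraction. -/
theorem exists_completelyPositiveMap_hasSum (V : ι → H →L[ℂ] K)
    (hV : ∀ (F : Finset ι) ξ, ∑ i ∈ F, ‖V i ξ‖ ^ 2 ≤ ‖ξ‖ ^ 2) :
    ∃ Φ : (K →L[ℂ] K) →CP (H →L[ℂ] H), ∀ A ξ η,
      HasSum (fun i => ⟪V i ξ, A (V i η)⟫_ℂ) ⟪ξ, Φ A η⟫_ℂ := by
  have hsum : ∀ ξ, Summable fun i => ‖V i ξ‖ ^ 2 := fun ξ =>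
    summable_of_sum_le (fun i => sq_nonneg _) (fun F => hV F ξ)
  have hterm : ∀ (A : K →L[ℂ] K) i ξ η, ‖⟪V i ξ, A (V i η)⟫_ℂ‖ ≤ ‖A‖ * (‖V i ξ‖ * ‖V i η‖) :=
    fun A i ξ η => calc
      _ ≤ ‖V i ξ‖ * ‖A (V i η)‖ := norm_inner_le_norm _ _
      _ ≤ ‖V i ξ‖ * (‖A‖ * ‖V i η‖) := by gcongr; exact A.le_opNorm _
      _ = _ := by ring
  have hsum2 : ∀ (A : K →L[ℂ] K) ξ η, Summable fun i => ⟪V i ξ, A (V i η)⟫_ℂ := fun A ξ η => by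
    refine Summable.of_norm_bounded (((hsum ξ).add (hsum η)).mul_left ‖A‖) fun i =>
      (hterm A i ξ η).trans ?_
    gcongr
    nlinarith [sq_nonneg (‖V i ξ‖ - ‖V i η‖), sq_nonneg ‖V i ξ‖, sq_nonneg ‖V i η‖]
  let S : (K →L[ℂ] K) → Finset ι → (H →L[ℂ] H) := fun A F => ∑ i ∈ F, adjoint (V i) ∘L A ∘L V i
  have hS : ∀ A F ξ η, ⟪ξ, S A F η⟫_ℂ = ∑ i ∈ F, ⟪V i ξ, A (V i η)⟫_ℂ := fun A F ξ η => by
    simp only [S, sum_apply, inner_sum, comp_apply, adjoint_inner_right]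
  have hnorm : ∀ A F, ‖S A F‖ ≤ ‖A‖ := fun A F => by
    refine opNorm_le_bound _ (norm_nonneg _) fun η => ?_
    have h1 : ∀ ξ, ‖⟪ξ, S A F η⟫_ℂ‖ ≤ ‖A‖ * (‖ξ‖ * ‖η‖) := fun ξ => by
      rw [hS]
      calc _ ≤ ∑ i ∈ F, ‖⟪V i ξ, A (V i η)⟫_ℂ‖ := norm_sum_le _ _
        _ ≤ ∑ i ∈ F, ‖A‖ * (‖V i ξ‖ * ‖V i η‖) := Finset.sum_le_sum fun i _ => hterm A i ξ η
        _ = ‖A‖ * ∑ i ∈ F, ‖V i ξ‖ * ‖V i η‖ := by rw [Finset.mul_sum]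
        _ ≤ _ := by
          gcongr
          refine abs_le_of_sq_le_sq' ?_ (by positivity) |>.2
          calc _ ≤ (∑ i ∈ F, ‖V i ξ‖ ^ 2) * ∑ i ∈ F, ‖V i η‖ ^ 2 :=
                Finset.sum_mul_sq_le_sq_mul_sq _ _ _
            _ ≤ ‖ξ‖ ^ 2 * ‖η‖ ^ 2 := by gcongr <;> exact hV _ _
            _ = _ := by ring
    -- Testing against the image vector itself turns the form bound into a norm bound.
    have h2 := h1 (S A F η)
    rw [inner_self_eq_norm_sq_to_K] at h2
    have h3 : ‖S A F η‖ * ‖S A F η‖ ≤ ‖S A F η‖ * (‖A‖ * ‖η‖) := by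
      have : ‖(((‖S A F η‖ : ℝ) : ℂ) ^ 2)‖ = ‖S A F η‖ * ‖S A F η‖ := by simp [sq]
      calc _ = _ := this.symm
        _ ≤ _ := h2
        _ = _ := by ring
    rcases (norm_nonneg (S A F η)).eq_or_lt with h0 | h0
    · rw [← h0]; positivity
    · exact le_of_mul_le_mul_left h3 h0
  have hex : ∀ A : K →L[ℂ] K, ∃ B : H →L[ℂ] H, ∀ ξ η, HasSum (fun i => ⟪V i ξ, A (V i η)⟫_ℂ) ⟪ξ, B η⟫_ℂ := by
    intro A
    obtain ⟨B, hB⟩ := exists_forall_tendsto_inner (F := atTop) (S A)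
      (Eventually.of_forall (hnorm A)) fun ξ η => ⟨_, by simpa only [hS] using! (hsum2 A ξ η).hasSum⟩
    exact ⟨B, fun ξ η => by simpa only [hS] using! hB ξ η⟩
  choose φ hφ using hex
  let Φ : (K →L[ℂ] K) →ₗ[ℂ] (H →L[ℂ] H) :=
    { toFun := φ
      map_add' := fun A B => ContinuousLinearMap.ext fun η => ext_inner_left ℂ fun ξ => by
        refine (hφ (A + B) ξ η).unique ?_
        simpa [inner_add_right] using (hφ A ξ η).add (hφ B ξ η)
      map_smul' := fun c A => ContinuousLinearMap.ext fun η => ext_inner_left ℂ fun ξ => by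
        refine (hφ (c • A) ξ η).unique ?_
        simpa [inner_smul_right] using (hφ A ξ η).mul_left c }
  refine ⟨⟨Φ, fun k M hM => ?_⟩, hφ⟩
  rw [CStarMatrix.nonneg_iff_inner] at hM ⊢
  intro ξ
  have h : HasSum (fun l => ∑ i, ∑ j, ⟪V l (ξ i), M i j (V l (ξ j))⟫_ℂ)
      (∑ i, ∑ j, ⟪ξ i, φ (M i j) (ξ j)⟫_ℂ) :=
    hasSum_sum fun i _ => hasSum_sum fun j _ => hφ (M i j) (ξ i) (ξ j)
  exact h.nonneg fun l => hM fun i => V l (ξ i)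

/-- The supremum is a weak limit of the directed set along a filter with eventually bounded norms.
Dominated convergence, with bound `C‖V i ξ‖²`, carries this limit through the Kraus sum. -/
theorem isLUB_image_of_hasSum {V : ι → H →L[ℂ] K} {Φ : (K →L[ℂ] K) →CP (H →L[ℂ] H)}
    (hΦ : ∀ A ξ η, HasSum (fun i => ⟪V i ξ, A (V i η)⟫_ℂ) ⟪ξ, Φ A η⟫_ℂ)
    {S : Set (K →L[ℂ] K)} (hne : S.Nonempty) (hdir : DirectedOn (· ≤ ·) S) {a : K →L[ℂ] K}
    (ha : IsLUB S a) : IsLUB (Φ '' S) (Φ a) := by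
  refine ⟨?_, fun b hb => ?_⟩
  · rintro _ ⟨s, hs, rfl⟩
    exact OrderHomClass.mono Φ (ha.1 hs)
  obtain ⟨a', ha', F, hF, ⟨C, hC⟩, hlim⟩ := exists_isLUB_tendsto_inner hne hdir ⟨a, ha.1⟩
  obtain rfl := ha.unique ha'
  refine le_iff_inner.2 fun ξ => ?_
  have hs : Summable fun i => C * ‖V i ξ‖ ^ 2 := by
    refine Summable.mul_left _ ?_
    have := (hΦ 1 ξ ξ).summable.norm
    simpa [inner_self_eq_norm_sq_to_K] using this
  have key : Tendsto (fun s : S => ⟪ξ, Φ s ξ⟫_ℂ) F (𝓝 ⟪ξ, Φ a ξ⟫_ℂ) := by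
    simp only [← (hΦ _ ξ ξ).tsum_eq]
    refine tendsto_tsum_of_dominated_convergence hs (fun i => hlim _ _) ?_
    filter_upwards [hC] with s hs i
    calc _ ≤ ‖V i ξ‖ * ‖(s : K →L[ℂ] K) (V i ξ)‖ := norm_inner_le_norm _ _
      _ ≤ ‖V i ξ‖ * (C * ‖V i ξ‖) := by gcongr; exact le_of_opNorm_le _ hs _
      _ = _ := by ring
  exact le_of_tendsto key <| Eventually.of_forall fun s =>
    le_iff_inner.1 (hb ⟨s, s.2, rfl⟩) ξ

end Kraus

/-! ### Schwarz inequality and supports of normal maps. -/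

section Normal

open ContinuousLinearMap

/-- The Schwarz inequality for unital completely positive maps. -/
theorem CompletelyPositiveMap.map_mul_self_le {K : Type*} [NormedAddCommGroup K]
    [InnerProductSpace ℂ K] [CompleteSpace K] {H : Type*} [NormedAddCommGroup H]
    [InnerProductSpace ℂ H] [CompleteSpace H] (Φ : (K →L[ℂ] K) →CP (H →L[ℂ] H)) (h1 : Φ 1 = 1)
    {a : K →L[ℂ] K} (ha : IsSelfAdjoint a) (hΦa : IsSelfAdjoint (Φ a)) :
    Φ a * Φ a ≤ Φ (a * a) := by
  -- This is `v* v` for the row `v = (1, a)`. Its image is tested below on `(-Φ(a)x, x)`, which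
  -- completes the square.
  let M : CStarMatrix (Fin 2) (Fin 2) (K →L[ℂ] K) := CStarMatrix.ofMatrix !![1, a; a, a * a]
  have hM : 0 ≤ M := CStarMatrix.nonneg_iff_inner.2 fun ξ => by
    have : ∑ i, ∑ j, ⟪ξ i, M i j (ξ j)⟫_ℂ = ⟪ξ 0 + a (ξ 1), ξ 0 + a (ξ 1)⟫_ℂ := by
      have e : ∀ x y, ⟪x, a y⟫_ℂ = ⟪a x, y⟫_ℂ := fun x y => (ha.isSymmetric x y).symm
      rw [inner_add_add_self]
      simp [M, Fin.sum_univ_two, e]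
      ring
    rw [this]
    exact inner_self_nonneg_complex _
  have h := CStarMatrix.nonneg_iff_inner.1 (Φ.map_cstarMatrix_nonneg M hM)
  refine le_iff_inner.2 fun x => ?_
  have hx := h ![-(Φ a x), x]
  simp [M, Fin.sum_univ_two, h1] at hx
  have e : ∀ x y, ⟪x, Φ a y⟫_ℂ = ⟪Φ a x, y⟫_ℂ := fun x y => (hΦa.isSymmetric x y).symm
  rw [mul_apply_eq_comp, e]
  simpa [e] using hx

theorem ringInverse_one_add_bounds {A : Type*} [CStarAlgebra A] [PartialOrder A]
    [StarOrderedRing A] {a : A} (ha : 0 ≤ a) :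
    0 ≤ Ring.inverse (1 + a) ∧ Ring.inverse (1 + a) ≤ 1 ∧
      a * Ring.inverse (1 + a) * a = a - (1 - Ring.inverse (1 + a)) ∧
      1 - Ring.inverse (1 + a) ≤ a := by
  have hpos : IsStrictlyPositive (1 + a) :=
    IsStrictlyPositive.of_le isStrictlyPositive_one (le_add_of_nonneg_right ha)
  have h1 : Ring.inverse (1 + a) ≤ 1 := by
    simpa using CStarAlgebra.ringInverse_le_ringInverse
      (le_add_of_nonneg_right ha : (1 : A) ≤ 1 + a) isStrictlyPositive_one
  have hu : IsUnit (1 + a) := hpos.isUnit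
  have h0 : 0 ≤ Ring.inverse (1 + a) := by
    rw [Ring.inverse_of_isUnit hu]
    exact CFC.inv_nonneg_of_nonneg hu.unit hpos.nonneg
  have e1 : Ring.inverse (1 + a) * (1 + a) = 1 := Ring.inverse_mul_cancel _ hu
  have e2 : (1 + a) * Ring.inverse (1 + a) = 1 := Ring.mul_inverse_cancel _ hu
  have e3 : a * Ring.inverse (1 + a) * a = a - (1 - Ring.inverse (1 + a)) := by
    have e4 : a * Ring.inverse (1 + a) = 1 - Ring.inverse (1 + a) := by
      rw [eq_sub_iff_add_eq, ← add_one_mul, add_comm a, e2]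
    have e5 : Ring.inverse (1 + a) * a = 1 - Ring.inverse (1 + a) := by
      rw [eq_sub_iff_add_eq, ← mul_add_one, add_comm a, e1]
    rw [e4, sub_mul, e5, one_mul]
  refine ⟨h0, h1, e3, ?_⟩
  rw [← sub_nonneg, ← e3]
  exact (IsSelfAdjoint.of_nonneg ha).conjugate_nonneg h0

/-- A normal unital completely positive map that vanishes on a family of positive operators vanishes
on every effect that is supported by the joint support of the family. -/
theorem IsChannel.map_eq_zero_of_forall_apply_eq_zero {K : Type u} [NormedAddCommGroup K]
    [InnerProductSpace ℂ K] [CompleteSpace K] {H : Type w} [NormedAddCommGroup H]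
    [InnerProductSpace ℂ H] [CompleteSpace H] {Φ : (K →L[ℂ] K) →CP (H →L[ℂ] H)}
    (hΦ : IsChannel Φ) {B : K →L[ℂ] K} (hB0 : 0 ≤ B) (hB1 : B ≤ 1)
    (h : ∀ u, (∀ a, 0 ≤ a → Φ a = 0 → a u = 0) → B u = 0) : Φ B = 0 := by
  -- For positive `a` killed by `Φ`, `1 - (1 + a)⁻¹` is an effect killed by `Φ` and increasing in
  -- `a`. Such `a` are closed under addition, so `D` is directed; normality makes `Φ` kill its
  -- supremum `Q`.
  let r : (K →L[ℂ] K) → (K →L[ℂ] K) := fun a => Ring.inverse (1 + a)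
  let D : Set (K →L[ℂ] K) := {d | ∃ a, 0 ≤ a ∧ Φ a = 0 ∧ d = 1 - r a}
  have hmono : ∀ {x y : K →L[ℂ] K}, x ≤ y → Φ x ≤ Φ y := fun h => OrderHomClass.mono Φ h
  have hnn : ∀ {x : K →L[ℂ] K}, 0 ≤ x → 0 ≤ Φ x := fun h => by simpa using hmono h
  have hr_anti : ∀ {a b : K →L[ℂ] K}, 0 ≤ a → a ≤ b → r b ≤ r a := fun {a b} ha hab =>
    CStarAlgebra.ringInverse_le_ringInverse
      (add_le_add_right hab 1)
      (IsStrictlyPositive.of_le isStrictlyPositive_one (le_add_of_nonneg_right ha))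
  have hD0 : ∀ d ∈ D, Φ d = 0 := by
    rintro _ ⟨a, ha, hΦa, rfl⟩
    obtain ⟨-, h1, -, h2⟩ := ringInverse_one_add_bounds ha
    exact le_antisymm (hΦa ▸ hmono h2) (hnn (sub_nonneg.2 h1))
  have hne : D.Nonempty := ⟨_, 0, le_rfl, map_zero Φ, rfl⟩
  have hdir : DirectedOn (· ≤ ·) D := by
    rintro _ ⟨a, ha, hΦa, rfl⟩ _ ⟨b, hb, hΦb, rfl⟩
    refine ⟨_, ⟨a + b, add_nonneg ha hb, by rw [map_add, hΦa, hΦb, add_zero], rfl⟩, ?_, ?_⟩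
    · exact sub_le_sub_left (hr_anti ha (le_add_of_nonneg_right hb)) _
    · exact sub_le_sub_left (hr_anti hb (le_add_of_nonneg_left ha)) _
  have hbd : (1 : K →L[ℂ] K) ∈ upperBounds D := by
    rintro _ ⟨a, ha, -, rfl⟩
    exact sub_le_self _ (ringInverse_one_add_bounds ha).1
  obtain ⟨Q, hQ, -⟩ := exists_isLUB_tendsto_inner hne hdir ⟨1, hbd⟩
  have hQ1 : Q ≤ 1 := hQ.2 hbd
  have hQ0 : 0 ≤ Q := by simpa [r] using hQ.1 (⟨0, le_rfl, map_zero Φ, rfl⟩ : 1 - r 0 ∈ D)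
  have hΦQ : Φ Q = 0 := by
    refine le_antisymm ((hΦ.normal D hne ?_ hdir Q hQ).2 ?_) (hnn hQ0)
    · rintro _ ⟨a, ha, -, rfl⟩
      exact .of_nonneg (sub_nonneg.2 (ringInverse_one_add_bounds ha).2.1)
    · rintro _ ⟨d, hd, rfl⟩
      exact (hD0 d hd).le
  set R : K →L[ℂ] K := 1 - Q with hR
  have hR0 : 0 ≤ R := sub_nonneg.2 hQ1
  have hRa : ∀ a, 0 ≤ a → Φ a = 0 → ∀ x, R (a x) = 0 := fun a ha hΦa x => by
    refine apply_eq_zero_of_inner_eq_zero hR0 ?_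
    -- Multiples `b = (n + 1)a` are also killed, so `R ≤ (1 + b)⁻¹` and `bRb ≤ b(1 + b)⁻¹b ≤ b`.
    -- Dividing by `n + 1` and letting `n` grow forces `R a = 0`.
    have key : ∀ n : ℕ, (⟪a x, R (a x)⟫_ℂ).re * (n + 1) ≤ (⟪x, a x⟫_ℂ).re := fun n => by
      have hb : 0 ≤ (n + 1) • a := nsmul_nonneg ha _
      have hΦb : Φ ((n + 1) • a) = 0 := by rw [map_nsmul, hΦa, smul_zero]
      obtain ⟨-, h1, h2, -⟩ := ringInverse_one_add_bounds hb
      have hRr : R ≤ Ring.inverse (1 + (n + 1) • a) := sub_le_comm.1 (hQ.1 ⟨_, hb, hΦb, rfl⟩)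
      have h3 := (IsSelfAdjoint.of_nonneg hb).conjugate_le_conjugate hRr
      rw [h2] at h3
      have h4 := re_inner_mono (h3.trans (sub_le_self _ (sub_nonneg.2 h1))) x
      have e1 := (IsSelfAdjoint.of_nonneg ha).isSymmetric x (R (a x))
      simp only [ContinuousLinearMap.coe_coe] at e1
      have e2 : (⟪x, ((n + 1) • a * R * ((n + 1) • a)) x⟫_ℂ).re =
          (n + 1) * ((n + 1) * (⟪a x, R (a x)⟫_ℂ).re) := by
        rw [e1]
        simp only [mul_apply_eq_comp, ← Nat.cast_smul_eq_nsmul ℂ, smul_apply, map_smul,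
          inner_smul_right, ← Complex.ofReal_natCast, Complex.re_ofReal_mul]
        push_cast; ring
      have e3 : (⟪x, ((n + 1) • a) x⟫_ℂ).re = (n + 1) * (⟪x, a x⟫_ℂ).re := by
        simp only [← Nat.cast_smul_eq_nsmul ℂ, smul_apply,
          inner_smul_right, ← Complex.ofReal_natCast, Complex.re_ofReal_mul]
        push_cast; ring
      rw [e2, e3] at h4
      have := le_of_mul_le_mul_left h4 (by positivity)
      linarith
    have h0 := re_inner_nonneg_of_nonneg hR0 (a x)
    rw [inner_eq_ofReal_re hR0]
    rcases h0.eq_or_lt with h0 | h0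
    · rw [← h0]; simp
    · obtain ⟨n, hn⟩ := exists_nat_gt ((⟪x, a x⟫_ℂ).re / (⟪a x, R (a x)⟫_ℂ).re)
      rw [div_lt_iff₀ h0] at hn
      nlinarith [key n]
  have haR : ∀ a, 0 ≤ a → Φ a = 0 → ∀ x, a (R x) = 0 := fun a ha hΦa x => by
    refine ext_inner_left ℂ fun y => ?_
    have e1 := (IsSelfAdjoint.of_nonneg ha).isSymmetric y (R x)
    have e2 := (IsSelfAdjoint.of_nonneg hR0).isSymmetric (a y) x
    simp only [ContinuousLinearMap.coe_coe] at e1 e2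
    rw [← e1, ← e2, hRa a ha hΦa]
    simp
  have hBR : B * R = 0 := ContinuousLinearMap.ext fun x =>
    h (R x) fun a ha hΦa => haR a ha hΦa x
  have hBQ : B * Q = B := by
    have : Q = 1 - R := by rw [hR, sub_sub_cancel]
    rw [this, mul_sub, hBR, mul_one, sub_zero]
  have hQs : IsSelfAdjoint Q := .of_nonneg hQ0
  have hBs : IsSelfAdjoint B := .of_nonneg hB0
  have hQB : Q * B = B := by
    rw [← hQs.star_eq, ← hBs.star_eq, ← star_mul, hBQ]
  -- `B = QBQ ≤ Q² ≤ Q`.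
  have hle : B ≤ Q := by
    have h1 : Q * B * Q ≤ Q * 1 * Q := hQs.conjugate_le_conjugate hB1
    rw [hQB, hBQ, mul_one, ← sq] at h1
    have h2 : Q ^ 2 ≤ Q ^ 1 := CStarAlgebra.pow_antitone hQ0 hQ1 one_le_two
    exact h1.trans (by simpa using h2)
  exact le_antisymm (hΦQ ▸ hmono hle) (hnn hB0)

end Normal

/-! ### Set functions dominated by a POVM, and sharp observables. -/

namespace POVM

open ContinuousLinearMap MeasureTheory

variable {Ω : Type*} [MeasurableSpace Ω]
  {H : Type*} [NormedAddCommGroup H] [InnerProductSpace ℂ H] [CompleteSpace H]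
  {K : Type*} [NormedAddCommGroup K] [InnerProductSpace ℂ K] [CompleteSpace K]

theorem op_empty (M : POVM Ω H) : M.op ∅ = 0 := by
  refine ContinuousLinearMap.ext fun ψ => ext_inner_left ℂ fun φ => ?_
  have h := M.op_iUnion (fun _ => ∅) (fun _ => MeasurableSet.empty) (fun i j _ => by simp) φ ψ
  have := tendsto_nhds_unique h.summable.tendsto_atTop_zero tendsto_const_nhds
  simpa using this.symm

theorem op_union (M : POVM Ω H) {s t : Set Ω} (hs : MeasurableSet s) (ht : MeasurableSet t)
    (hst : Disjoint s t) : M.op (s ∪ t) = M.op s + M.op t := by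
  refine ContinuousLinearMap.ext fun ψ => ext_inner_left ℂ fun φ => ?_
  let X : ℕ → Set Ω := fun n => if n = 0 then s else if n = 1 then t else ∅
  have hX : ⋃ n, X n = s ∪ t := by
    ext x
    simp only [Set.mem_iUnion, X, Set.mem_union]
    constructor
    · rintro ⟨n, hn⟩
      split_ifs at hn
      · exact Or.inl hn
      · exact Or.inr hn
      · exact hn.elim
    · rintro (h | h)
      · exact ⟨0, by simpa using h⟩
      · exact ⟨1, by simpa using h⟩
  have h := M.op_iUnion X (fun n => by dsimp only [X]; split_ifs <;> simp [hs, ht])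
    (fun i j hij => by
      dsimp only [X]
      split_ifs <;> first | omega | exact hst | exact hst.symm | simp) φ ψ
  rw [hX] at h
  have h2 : HasSum (fun j => ⟪φ, M.op (X j) ψ⟫_ℂ) (∑ j ∈ Finset.range 2, ⟪φ, M.op (X j) ψ⟫_ℂ) :=
    hasSum_sum_of_ne_finset_zero fun n hn => by
      have h0 : n ≠ 0 := fun h => by simp [h] at hn
      have h1 : n ≠ 1 := fun h => by simp [h] at hn
      simp [X, h0, h1, op_empty]
  rw [h.unique h2]
  simp [Finset.sum_range_succ, X, inner_add_right]

/-- A positive finitely additive operator-valued set function dominated by a POVM. -/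
structure Dominates (M : POVM Ω H) (N : Set Ω → (H →L[ℂ] H)) : Prop where
  nonneg : ∀ s, MeasurableSet s → 0 ≤ N s
  le_op : ∀ s, MeasurableSet s → N s ≤ M.op s
  union : ∀ s t, MeasurableSet s → MeasurableSet t → Disjoint s t → N (s ∪ t) = N s + N t

theorem dominates_op (M : POVM Ω H) : M.Dominates M.op :=
  ⟨M.op_nonneg, fun _ _ => le_rfl, fun _ _ hs ht hst => M.op_union hs ht hst⟩

namespace Dominates

variable {M : POVM Ω H} {N : Set Ω → (H →L[ℂ] H)}

theorem empty (hN : M.Dominates N) : N ∅ = 0 := by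
  have := hN.union ∅ ∅ .empty .empty (by simp)
  simpa using this

theorem mono (hN : M.Dominates N) {s t : Set Ω} (hs : MeasurableSet s) (ht : MeasurableSet t)
    (hst : s ⊆ t) : N s ≤ N t := by
  have h := hN.union s (t \ s) hs (ht.diff hs) Set.disjoint_sdiff_right
  rw [Set.union_sdiff_cancel hst] at h
  rw [h]
  exact le_add_of_nonneg_right (hN.nonneg _ (ht.diff hs))

theorem le_one (hN : M.Dominates N) {s : Set Ω} (hs : MeasurableSet s) : N s ≤ 1 :=
  (hN.le_op s hs).trans (M.op_univ ▸ M.dominates_op.mono hs .univ (Set.subset_univ s))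

theorem sum_le (hN : M.Dominates N) {ι : Type*} (F : Finset ι) {X : ι → Set Ω} {U : Set Ω}
    (hX : ∀ i, MeasurableSet (X i)) (hU : MeasurableSet U)
    (hd : Pairwise fun i j => Disjoint (X i) (X j)) (hXU : ∀ i, X i ⊆ U) :
    ∑ i ∈ F, N (X i) ≤ N U := by
  classical
  have h : ∑ i ∈ F, N (X i) = N (⋃ i ∈ F, X i) := by
    induction F using Finset.induction_on with
    | empty => simp [hN.empty]
    | insert a F ha ih =>
      rw [Finset.sum_insert ha, ih, Finset.set_biUnion_insert, hN.union _ _ (hX a)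
        (Finset.measurableSet_biUnion _ fun i _ => hX i)]
      rw [Set.disjoint_iUnion₂_right]
      exact fun i hi => hd fun h => ha (h ▸ hi)
  rw [h]
  exact hN.mono (Finset.measurableSet_biUnion _ fun i _ => hX i) hU (Set.iUnion₂_subset fun i _ => hXU i)

theorem inter (hN : M.Dominates N) {Y : Set Ω} (hY : MeasurableSet Y) :
    M.Dominates fun s => N (s ∩ Y) where
  nonneg s hs := hN.nonneg _ (hs.inter hY)
  le_op s hs := (hN.mono (hs.inter hY) hs Set.inter_subset_left).trans (hN.le_op s hs)
  union s t hs ht hst := by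
    rw [Set.union_inter_distrib_right]
    exact hN.union _ _ (hs.inter hY) (ht.inter hY)
      (hst.mono Set.inter_subset_left Set.inter_subset_left)

theorem sub (hN : M.Dominates N) : M.Dominates fun s => M.op s - N s where
  nonneg s hs := sub_nonneg.2 (hN.le_op s hs)
  le_op s hs := sub_le_self _ (hN.nonneg s hs)
  union s t hs ht hst := by
    rw [hN.union s t hs ht hst, M.op_union hs ht hst]; abel

/-- Finite additivity and positivity give `∑ N(X j) ≤ N(⋃ X j)` for `N` and for `M - N`. The two
inequalities add up to the σ-additivity of `M`, so both are equalities. -/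
theorem hasSum_re_inner (hN : M.Dominates N) (φ : H) {X : ℕ → Set Ω}
    (hX : ∀ j, MeasurableSet (X j)) (hd : Pairwise fun i j => Disjoint (X i) (X j)) :
    HasSum (fun j => (⟪φ, N (X j) φ⟫_ℂ).re) (⟪φ, N (⋃ j, X j) φ⟫_ℂ).re := by
  have key : ∀ {N : Set Ω → (H →L[ℂ] H)}, M.Dominates N →
      Summable (fun j => (⟪φ, N (X j) φ⟫_ℂ).re) ∧
        ∑' j, (⟪φ, N (X j) φ⟫_ℂ).re ≤ (⟪φ, N (⋃ j, X j) φ⟫_ℂ).re := fun {N} hN => by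
    have h0 : ∀ j, 0 ≤ (⟪φ, N (X j) φ⟫_ℂ).re := fun j =>
      re_inner_nonneg_of_nonneg (hN.nonneg _ (hX j)) φ
    have h1 : ∀ F : Finset ℕ, ∑ j ∈ F, (⟪φ, N (X j) φ⟫_ℂ).re ≤ (⟪φ, N (⋃ j, X j) φ⟫_ℂ).re :=
      fun F => by
        have := re_inner_mono (hN.sum_le F hX (MeasurableSet.iUnion hX) hd
          (Set.subset_iUnion X)) φ
        simpa [sum_apply, inner_sum] using this
    exact ⟨summable_of_sum_le h0 h1, Real.tsum_le_of_sum_le h0 h1⟩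
  obtain ⟨hs1, hl1⟩ := key hN
  obtain ⟨hs2, hl2⟩ := key hN.sub
  have h3 := (Complex.hasSum_re (M.op_iUnion X hX hd φ φ)).tsum_eq
  have h4 := hs1.tsum_add hs2
  simp only [sub_apply, inner_sub_right, Complex.sub_re, add_sub_cancel] at h4 hl2
  exact hs1.hasSum_iff.2 (by linarith)

theorem exists_measure (hN : M.Dominates N) (φ : H) :
    ∃ ν : Measure Ω, IsFiniteMeasure ν ∧
      ∀ X, MeasurableSet X → ν X = ENNReal.ofReal (⟪φ, N X φ⟫_ℂ).re := by
  refine ⟨Measure.ofMeasurable (fun s _ => ENNReal.ofReal (⟪φ, N s φ⟫_ℂ).re)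
    (by simp [hN.empty]) fun X hX hd => ?_, ⟨?_⟩, fun X hX => Measure.ofMeasurable_apply _ hX⟩
  · have h := hN.hasSum_re_inner φ hX hd
    rw [← h.tsum_eq, ENNReal.ofReal_tsum_of_nonneg
      (fun j => re_inner_nonneg_of_nonneg (hN.nonneg _ (hX j)) φ) h.summable]
  · rw [Measure.ofMeasurable_apply _ .univ]
    exact ENNReal.ofReal_lt_top

/-- A Cauchy–Schwarz inequality for integrals of simple functions. -/
theorem norm_sq_inner_sum_le (hN : M.Dominates N) (ξ φ : H) (f : SimpleFunc Ω ℂ) {X : Set Ω}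
    (hX : MeasurableSet X) :
    ‖⟪ξ, ∑ y ∈ f.range, y • N (X ∩ f ⁻¹' {y}) φ⟫_ℂ‖ ^ 2 ≤
      (⟪ξ, N X ξ⟫_ℂ).re * ∑ y ∈ f.range, ‖y‖ ^ 2 * (⟪φ, N (f ⁻¹' {y}) φ⟫_ℂ).re := by
  have hm : ∀ y, MeasurableSet (X ∩ f ⁻¹' {y}) := fun y => hX.inter (f.measurableSet_fiber y)
  set a : ℂ → ℝ := fun y => (⟪ξ, N (X ∩ f ⁻¹' {y}) ξ⟫_ℂ).re
  set b : ℂ → ℝ := fun y => (⟪φ, N (X ∩ f ⁻¹' {y}) φ⟫_ℂ).re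
  have ha : ∀ y, 0 ≤ a y := fun y => re_inner_nonneg_of_nonneg (hN.nonneg _ (hm y)) ξ
  have hb : ∀ y, 0 ≤ b y := fun y => re_inner_nonneg_of_nonneg (hN.nonneg _ (hm y)) φ
  have h1 : ∀ y, ‖⟪ξ, y • N (X ∩ f ⁻¹' {y}) φ⟫_ℂ‖ ≤ √(a y) * (‖y‖ * √(b y)) := fun y => by
    rw [inner_smul_right, norm_mul, mul_left_comm, ← Real.sqrt_mul (ha y)]
    gcongr
    exact Real.le_sqrt_of_sq_le (norm_inner_sq_le_of_nonneg (hN.nonneg _ (hm y)) ξ φ)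
  have h2 : ‖⟪ξ, ∑ y ∈ f.range, y • N (X ∩ f ⁻¹' {y}) φ⟫_ℂ‖ ≤
      ∑ y ∈ f.range, √(a y) * (‖y‖ * √(b y)) := by
    rw [inner_sum]
    exact (norm_sum_le _ _).trans (Finset.sum_le_sum fun y _ => h1 y)
  calc _ ≤ (∑ y ∈ f.range, √(a y) * (‖y‖ * √(b y))) ^ 2 := by gcongr
    _ ≤ (∑ y ∈ f.range, √(a y) ^ 2) * ∑ y ∈ f.range, (‖y‖ * √(b y)) ^ 2 :=
      Finset.sum_mul_sq_le_sq_mul_sq _ _ _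
    _ = (∑ y ∈ f.range, a y) * ∑ y ∈ f.range, ‖y‖ ^ 2 * b y := by
      simp only [mul_pow, Real.sq_sqrt (ha _), Real.sq_sqrt (hb _)]
    _ ≤ _ := by
      gcongr with y hy
      · exact Finset.sum_nonneg fun y _ => mul_nonneg (sq_nonneg _) (hb y)
      · exact re_inner_nonneg_of_nonneg (hN.nonneg _ hX) ξ
      · have := re_inner_mono (hN.sum_le f.range hm hX (fun y z hyz => ?_)
          fun y => Set.inter_subset_left) ξ
        · simpa [sum_apply, inner_sum] using this
        · refine Disjoint.mono Set.inter_subset_right Set.inter_subset_right ?_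
          exact Disjoint.preimage _ (by simpa using hyz)
      · exact re_inner_mono (hN.mono (hm y) (f.measurableSet_fiber y) Set.inter_subset_right) φ

end Dominates

/-- Integration of simple functions against a finitely additive vector-valued set function. -/
theorem exists_linearMap_simpleFunc {V : Type*} [NormedAddCommGroup V] [NormedSpace ℂ V]
    (m : Set Ω → V) (hm : ∀ s t, MeasurableSet s → MeasurableSet t → Disjoint s t →
      m (s ∪ t) = m s + m t) :
    ∃ T : SimpleFunc Ω ℂ →ₗ[ℂ] V, (∀ f, T f = ∑ y ∈ f.range, y • m (f ⁻¹' {y})) ∧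
      ∀ s (hs : MeasurableSet s), T (SimpleFunc.piecewise s hs (SimpleFunc.const Ω 1)
        (SimpleFunc.const Ω 0)) = m s := by
  let D : Set Ω → ℂ →L[ℝ] V := fun s => (toSpanSingleton ℂ (m s)).restrictScalars ℝ
  have hD : ∀ s c, D s c = c • m s := fun s c => by simp [D]
  -- With the zero measure, the finiteness and integrability conditions hold trivially; only
  -- additivity on measurable sets matters.
  have hadd : FinMeasAdditive (0 : Measure Ω) D := fun s t hs ht _ _ hst => by
    ext c
    simp only [hD, hm s t hs ht hst, add_apply, smul_add]
  have hint : ∀ f : SimpleFunc Ω ℂ, Integrable f (0 : Measure Ω) := fun f =>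
    integrable_zero_measure
  have hm0 : m ∅ = 0 := by simpa using hm ∅ ∅ .empty .empty (by simp)
  refine ⟨⟨⟨SimpleFunc.setToSimpleFunc D, fun f g =>
    SimpleFunc.setToSimpleFunc_add D hadd (hint f) (hint g)⟩, fun c f =>
    SimpleFunc.setToSimpleFunc_smul D hadd (fun c s x => by simp only [hD, smul_assoc]) c (hint f)⟩,
    fun f => ?_, fun s hs =>
      (SimpleFunc.setToSimpleFunc_indicator D ?_ hs (1 : ℂ)).trans ?_⟩
  · exact Finset.sum_congr rfl fun y _ => hD _ _
  · ext; simp [hD, hm0]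
  · rw [hD, one_smul]

namespace IsPVM

variable {E : POVM Ω K}

/-- For projections `p`, `q` with `p + q` a projection, `pq + qp = 0`. Multiplying by `p` on either
side gives `pq = -pqp = qp`, so `2pq = 0`. -/
theorem mul_eq_zero (hE : E.IsPVM) {s t : Set Ω} (hs : MeasurableSet s) (ht : MeasurableSet t)
    (hst : Disjoint s t) : E.op s * E.op t = 0 := by
  have h1 := (hE s hs).isIdempotentElem.eq
  have h2 := (hE t ht).isIdempotentElem.eq
  have h3 := (hE (s ∪ t) (hs.union ht)).isIdempotentElem.eq
  rw [E.op_union hs ht hst] at h3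
  generalize E.op s = p at *
  generalize E.op t = q at *
  have h4 : p * q + q * p = 0 := by
    have : (p + q) * (p + q) = p * p + q * q + (p * q + q * p) := by noncomm_ring
    rw [this, h1, h2] at h3
    simpa using h3
  have h5 : p * q = - (p * q * p) := by
    have := congrArg (p * ·) h4
    simp only [mul_add, mul_zero, ← mul_assoc, h1] at this
    exact eq_neg_of_add_eq_zero_left this
  have h6 : q * p = - (p * q * p) := by
    have := congrArg (· * p) h4
    simp only [add_mul, zero_mul, mul_assoc, h1] at this
    rw [mul_assoc]
    exact eq_neg_of_add_eq_zero_right this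
  have h7 : p * q = q * p := h5.trans h6.symm
  have h8 : (2 : ℂ) • (p * q) = 0 := by
    rw [two_smul]
    nth_rewrite 2 [h7]
    exact h4
  simpa using h8

theorem mul_eq_inter (hE : E.IsPVM) {s t : Set Ω} (hs : MeasurableSet s) (ht : MeasurableSet t) :
    E.op s * E.op t = E.op (s ∩ t) := by
  have e1 : E.op s = E.op (s ∩ t) + E.op (s \ t) := by
    rw [← E.op_union (hs.inter ht) (hs.diff ht) Set.disjoint_sdiff_inter.symm,
      Set.inter_union_sdiff]
  have e2 : E.op t = E.op (s ∩ t) + E.op (t \ s) := by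
    rw [← E.op_union (hs.inter ht) (ht.diff hs), Set.inter_comm, Set.inter_union_sdiff]
    rw [Set.inter_comm]; exact Set.disjoint_sdiff_inter.symm
  rw [e1, add_mul, hE.mul_eq_zero (hs.diff ht) ht Set.disjoint_sdiff_left, add_zero, e2, mul_add,
    hE.mul_eq_zero (hs.inter ht) (ht.diff hs)
      (Set.disjoint_sdiff_right.mono_left Set.inter_subset_left), add_zero,
    (hE _ (hs.inter ht)).isIdempotentElem.eq]

theorem inner_apply_apply (hE : E.IsPVM) {s : Set Ω} (hs : MeasurableSet s) (x y : K) :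
    ⟪E.op s x, E.op s y⟫_ℂ = ⟪x, E.op s y⟫_ℂ := by
  have h := (hE s hs).isSelfAdjoint.isSymmetric x (E.op s y)
  simp only [ContinuousLinearMap.coe_coe] at h
  rw [h, ← mul_apply_eq_comp, (hE s hs).isIdempotentElem.eq]

theorem re_inner_eq_norm_sq (hE : E.IsPVM) {s : Set Ω} (hs : MeasurableSet s) (x : K) :
    (⟪x, E.op s x⟫_ℂ).re = ‖E.op s x‖ ^ 2 := by
  rw [← hE.inner_apply_apply hs, inner_self_eq_norm_sq_to_K]; norm_cast

theorem norm_sq_sum (hE : E.IsPVM) (f : SimpleFunc Ω ℂ) (ψ : K) :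
    ‖∑ y ∈ f.range, y • E.op (f ⁻¹' {y}) ψ‖ ^ 2 =
      ∑ y ∈ f.range, ‖y‖ ^ 2 * (⟪ψ, E.op (f ⁻¹' {y}) ψ⟫_ℂ).re := by
  have h : ∀ y, ∀ z, y ≠ z →
      ⟪y • E.op (f ⁻¹' {y}) ψ, z • E.op (f ⁻¹' {z}) ψ⟫_ℂ = 0 := fun y z hyz => by
    have hs := (hE _ (f.measurableSet_fiber y)).isSelfAdjoint.isSymmetric ψ (E.op (f ⁻¹' {z}) ψ)
    simp only [ContinuousLinearMap.coe_coe] at hs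
    rw [inner_smul_left, inner_smul_right, hs, ← mul_apply_eq_comp,
      hE.mul_eq_zero (f.measurableSet_fiber y) (f.measurableSet_fiber z)
        (Disjoint.preimage _ (by simpa using hyz))]
    simp
  have h2 : ⟪∑ y ∈ f.range, y • E.op (f ⁻¹' {y}) ψ, ∑ y ∈ f.range, y • E.op (f ⁻¹' {y}) ψ⟫_ℂ =
      ∑ y ∈ f.range, ⟪y • E.op (f ⁻¹' {y}) ψ, y • E.op (f ⁻¹' {y}) ψ⟫_ℂ := by
    simp only [sum_inner, inner_sum]
    exact Finset.sum_congr rfl fun y hy =>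
      Finset.sum_eq_single_of_mem y hy fun z _ hz => h z y hz
  simp only [inner_self_eq_norm_sq_to_K] at h2
  have h3 : ‖∑ y ∈ f.range, y • E.op (f ⁻¹' {y}) ψ‖ ^ 2 =
      ∑ y ∈ f.range, ‖y • E.op (f ⁻¹' {y}) ψ‖ ^ 2 := by exact_mod_cast h2
  rw [h3]
  exact Finset.sum_congr rfl fun y _ => by
    rw [norm_smul, mul_pow, hE.re_inner_eq_norm_sq (f.measurableSet_fiber y)]

end IsPVM

/-- If the scalar measure `⟨φ, N φ⟩` is dominated by `⟨ψ, E ψ⟩` with `E` sharp, then the map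
`E(Z)ψ ↦ N(Z)φ` gives an operator that pulls `E` back to something dominated by `N`. -/
theorem exists_norm_sq_apply_le {E : POVM Ω K} (hE : E.IsPVM) {M : POVM Ω H}
    {N : Set Ω → (H →L[ℂ] H)} (hN : M.Dominates N) (φ : H) (ψ : K) {c : ℝ} (hc : 0 ≤ c)
    (h : ∀ Z, MeasurableSet Z → (⟪φ, N Z φ⟫_ℂ).re ≤ c * (⟪ψ, E.op Z ψ⟫_ℂ).re) :
    ∃ V : H →L[ℂ] K, (V = 0 → N Set.univ φ = 0) ∧
      ∀ X, MeasurableSet X → ∀ ξ, ‖E.op X (V ξ)‖ ^ 2 ≤ c * (⟪ξ, N X ξ⟫_ℂ).re := by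
  obtain ⟨T₁, hT₁, hT₁'⟩ := exists_linearMap_simpleFunc (fun s => E.op s ψ)
    fun s t hs ht hst => by rw [E.op_union hs ht hst]; rfl
  obtain ⟨T₂, hT₂, hT₂'⟩ := exists_linearMap_simpleFunc (fun s => N s φ)
    fun s t hs ht hst => by rw [hN.union s t hs ht hst]; rfl
  have hCS : ∀ (f : SimpleFunc Ω ℂ) ξ X, MeasurableSet X → ‖⟪ξ, ∑ y ∈ f.range, y • N (X ∩ f ⁻¹' {y}) φ⟫_ℂ‖ ^ 2 ≤
      c * (⟪ξ, N X ξ⟫_ℂ).re * ‖T₁ f‖ ^ 2 := fun f ξ X hX => by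
    refine (hN.norm_sq_inner_sum_le ξ φ f hX).trans ?_
    rw [hT₁, hE.norm_sq_sum, mul_comm c, mul_assoc, Finset.mul_sum _ _ c]
    refine mul_le_mul_of_nonneg_left (Finset.sum_le_sum fun y _ => ?_)
      (re_inner_nonneg_of_nonneg (hN.nonneg X hX) ξ)
    rw [mul_left_comm]
    exact mul_le_mul_of_nonneg_left (h _ (f.measurableSet_fiber y)) (sq_nonneg _)
  -- Taking `ξ = T₂ f` and `X = Ω` in `hCS` gives `‖T₂ f‖⁴ ≤ c ‖T₂ f‖² ‖T₁ f‖²`.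
  have hbd : ∀ f, ‖T₂ f‖ ≤ √c * ‖T₁ f‖ := fun f => by
    have h1 := hCS f (T₂ f) Set.univ .univ
    simp only [Set.univ_inter, ← hT₂] at h1
    have h2 := re_inner_mono (hN.le_one .univ) (T₂ f)
    rw [one_apply_eq_self] at h2
    rw [inner_self_eq_norm_sq_to_K] at h1 h2
    have e1 : (((‖T₂ f‖ : ℝ) : ℂ) ^ 2).re = ‖T₂ f‖ ^ 2 := by norm_cast
    have e2 : ‖(((‖T₂ f‖ : ℝ) : ℂ) ^ 2)‖ = ‖T₂ f‖ ^ 2 := by simp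
    simp only [Complex.coe_algebraMap] at h1 h2
    rw [e1] at h2
    rw [e2] at h1
    rcases (norm_nonneg (T₂ f)).eq_or_lt with h0 | h0
    · rw [← h0]; positivity
    · rw [← Real.sqrt_sq (norm_nonneg (T₁ f)), ← Real.sqrt_mul hc]
      refine Real.le_sqrt_of_sq_le ?_
      have h3 : ‖T₂ f‖ ^ 2 * ‖T₂ f‖ ^ 2 ≤ ‖T₂ f‖ ^ 2 * (c * ‖T₁ f‖ ^ 2) := by
        calc _ = (‖T₂ f‖ ^ 2) ^ 2 := by ring
          _ ≤ _ := h1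
          _ ≤ c * ‖T₂ f‖ ^ 2 * ‖T₁ f‖ ^ 2 := by gcongr
          _ = _ := by ring
      exact le_of_mul_le_mul_left h3 (by positivity)
  -- The cyclic subspace of `ψ`. The map `T₁ f ↦ T₂ f` extends to it, and then by zero to its
  -- complement.
  let C : Submodule ℂ K := (LinearMap.range T₁).topologicalClosure
  have : CompleteSpace C := (Submodule.isClosed_topologicalClosure _).completeSpace_coe
  have hTC : ∀ f, T₁ f ∈ C := fun f => Submodule.le_topologicalClosure _ ⟨f, rfl⟩
  let e : SimpleFunc Ω ℂ →ₗ[ℂ] C := T₁.codRestrict C hTC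
  have hdense : DenseRange e := by
    intro x
    rw [Metric.mem_closure_range_iff]
    intro ε hε
    have hx : (x : K) ∈ closure (Set.range T₁) := by
      have := x.2
      exact this
    exact (Metric.mem_closure_range_iff.1 hx) ε hε
  let W : C →L[ℂ] H := T₂.extendOfNorm e
  have hW : ∀ f, W (e f) = T₂ f := LinearMap.extendOfNorm_eq hdense ⟨√c, hbd⟩
  let W' : K →L[ℂ] H := W ∘L C.orthogonalProjectionOnto
  have hW' : ∀ f, W' (T₁ f) = T₂ f := fun f => by
    rw [← hW]
    exact congrArg W (Submodule.orthogonalProjectionOnto_mem_subspace_eq_self (e f))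
  have hWE : ∀ Z, MeasurableSet Z → W' (E.op Z ψ) = N Z φ := fun Z hZ => by
    rw [← hT₁' Z hZ, ← hT₂' Z hZ, hW']
  refine ⟨adjoint W', fun hV => ?_, fun X hX ξ => ?_⟩
  · have : W' = 0 := by simpa using hV
    rw [← hWE _ .univ, this, zero_apply]
  have hVC : adjoint W' ξ ∈ C := by
    rw [adjoint_comp, Submodule.adjoint_orthogonalProjectionOnto]
    exact (adjoint W ξ).2
  have hET : ∀ f, E.op X (T₁ f) = ∑ y ∈ f.range, y • E.op (X ∩ f ⁻¹' {y}) ψ := fun f => by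
    rw [hT₁, map_sum]
    refine Finset.sum_congr rfl fun y _ => ?_
    rw [map_smul, ← mul_apply_eq_comp, hE.mul_eq_inter hX (f.measurableSet_fiber y)]
  have hEC : ∀ u ∈ C, E.op X u ∈ C := fun u hu => by
    refine map_mem_closure (E.op X).continuous hu ?_
    rintro _ ⟨f, rfl⟩
    rw [hET]
    exact Submodule.sum_mem _ fun y _ => Submodule.smul_mem _ _
      ⟨_, hT₁' _ (hX.inter (f.measurableSet_fiber y))⟩
  set v := E.op X (adjoint W' ξ) with hv
  have hvC : v ∈ C := hEC _ hVC
  set B : ℝ := c * (⟪ξ, N X ξ⟫_ℂ).re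
  have hB : 0 ≤ B := mul_nonneg hc (re_inner_nonneg_of_nonneg (hN.nonneg X hX) ξ)
  -- Since `v` lies in `C`, its norm is determined by pairing with the vectors `T₁ f`. Moving `E(X)`
  -- and the adjoint across reduces each pairing to `hCS`.
  have hf : ∀ f, ‖⟪T₁ f, v⟫_ℂ‖ ≤ √B * ‖T₁ f‖ := fun f => by
    have e1 := (hE X hX).isSelfAdjoint.isSymmetric (T₁ f) (adjoint W' ξ)
    simp only [ContinuousLinearMap.coe_coe] at e1
    have e2 : W' (E.op X (T₁ f)) = ∑ y ∈ f.range, y • N (X ∩ f ⁻¹' {y}) φ := by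
      rw [hET, map_sum]
      exact Finset.sum_congr rfl fun y _ => by
        rw [map_smul, hWE _ (hX.inter (f.measurableSet_fiber y))]
    rw [hv, ← e1, adjoint_inner_right, e2, norm_inner_symm, ← Real.sqrt_sq (norm_nonneg (T₁ f)),
      ← Real.sqrt_mul hB]
    exact Real.le_sqrt_of_sq_le (hCS f ξ X hX)
  have hcl : ∀ u ∈ C, ‖⟪u, v⟫_ℂ‖ ≤ √B * ‖u‖ := fun u hu => by
    refine closure_minimal (s := Set.range T₁) (t := {u | ‖⟪u, v⟫_ℂ‖ ≤ √B * ‖u‖}) ?_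
      (isClosed_le (by fun_prop) (by fun_prop)) hu
    rintro _ ⟨f, rfl⟩
    exact hf f
  have h1 := hcl v hvC
  have e3 : ‖⟪v, v⟫_ℂ‖ = ‖v‖ * ‖v‖ := by
    rw [inner_self_eq_norm_sq_to_K]; simp [sq]
  rw [e3] at h1
  rcases (norm_nonneg v).eq_or_lt with h0 | h0
  · rw [← h0]; simpa using hB
  · have h2 := le_of_mul_le_mul_right h1 h0
    calc ‖v‖ ^ 2 ≤ √B ^ 2 := by gcongr
      _ = B := Real.sq_sqrt hB

end POVM

/-! ### Radon–Nikodym theorem relative to a sharp observable. -/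

namespace POVM

open ContinuousLinearMap MeasureTheory

variable {Ω : Type*} [MeasurableSpace Ω]
  {H : Type*} [NormedAddCommGroup H] [InnerProductSpace ℂ H] [CompleteSpace H]
  {K : Type*} [NormedAddCommGroup K] [InnerProductSpace ℂ K] [CompleteSpace K]

/-- A nonzero set function dominated by `M ≪ E`, with `E` sharp on a separable space, dominates a
nonzero pullback of `E`. -/
theorem Dominates.exists_ne_zero_norm_sq_apply_le [TopologicalSpace.SeparableSpace K]
    {E : POVM Ω K} (hE : E.IsPVM) {M : POVM Ω H} (hM : M.AbsCont E)
    {N : Set Ω → (H →L[ℂ] H)} (hN : M.Dominates N) (h0 : N Set.univ ≠ 0) :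
    ∃ V : H →L[ℂ] K, V ≠ 0 ∧ ∃ c : ℝ, 0 ≤ c ∧
      ∀ X, MeasurableSet X → ∀ ξ, ‖E.op X (V ξ)‖ ^ 2 ≤ c * (⟪ξ, N X ξ⟫_ℂ).re := by
  obtain ⟨φ, hφ⟩ : ∃ φ, ⟪φ, N Set.univ φ⟫_ℂ ≠ 0 := by
    by_contra! h
    exact h0 (eq_zero_of_inner_eq_zero (hN.nonneg _ .univ) h)
  have hφ' : 0 < (⟪φ, N Set.univ φ⟫_ℂ).re := by
    refine (re_inner_nonneg_of_nonneg (hN.nonneg _ .univ) φ).lt_of_ne fun h => hφ ?_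
    rw [inner_eq_ofReal_re (hN.nonneg _ .univ), ← h, Complex.ofReal_zero]
  obtain ⟨ν, hνf, hν⟩ := hN.exists_measure φ
  choose μ hμf hμ using fun ψ => E.dominates_op.exists_measure ψ
  obtain ⟨ψ, hψ⟩ : ∃ ψ, ¬ (μ ψ ⟂ₘ ν) := by
    -- If `ν` were singular to `μ ψ` for every `ψ` of a dense sequence, the intersection of the
    -- separating sets would be `E`-null, hence `N`-null, yet would carry all of `ν`.
    by_contra! h
    choose s hs hs1 hs2 using fun n => h (TopologicalSpace.denseSeq K n)
    have hYm : MeasurableSet (⋂ n, s n) := .iInter hs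
    have hEY : E.op (⋂ n, s n) = 0 := by
      refine DFunLike.coe_injective <| Continuous.ext_on (TopologicalSpace.denseRange_denseSeq K)
        (E.op (⋂ n, s n)).continuous (0 : K →L[ℂ] K).continuous ?_
      rintro _ ⟨n, rfl⟩
      have h1 : μ (TopologicalSpace.denseSeq K n) (⋂ n, s n) = 0 :=
        measure_mono_null (Set.iInter_subset _ n) (hs1 n)
      rw [hμ _ _ hYm, ENNReal.ofReal_eq_zero, hE.re_inner_eq_norm_sq hYm] at h1
      have h2 := norm_nonneg (E.op (⋂ n, s n) (TopologicalSpace.denseSeq K n))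
      have h3 : ‖E.op (⋂ n, s n) (TopologicalSpace.denseSeq K n)‖ = 0 := by nlinarith
      simpa using h3
    have hNY : N (⋂ n, s n) = 0 :=
      le_antisymm ((hN.le_op _ hYm).trans (hM _ hYm hEY).le) (hN.nonneg _ hYm)
    have hν1 : ν (⋂ n, s n) = 0 := by rw [hν _ hYm, hNY]; simp
    have hν2 : ν (⋂ n, s n)ᶜ = 0 := by
      rw [Set.compl_iInter]
      exact measure_iUnion_null hs2
    have hν3 : ν Set.univ = 0 := by
      rw [← Set.union_compl_self (⋂ n, s n)]
      exact measure_union_null hν1 hν2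
    rw [hν _ .univ, ENNReal.ofReal_eq_zero] at hν3
    exact hφ'.not_ge hν3
  obtain ⟨ε, hε, Y, hY, hνY, hle⟩ := Measure.exists_positive_of_not_mutuallySingular _ _ hψ
  have hε' : (0 : ℝ) < ε := hε
  obtain ⟨V, hV0, hV⟩ := exists_norm_sq_apply_le hE (hN.inter hY) φ ψ
    (c := (ε : ℝ)⁻¹) (by positivity) fun Z hZ => by
      have h1 := hle Z hZ
      have hZY := hZ.inter hY
      rw [hν _ hZY, hμ _ _ hZY, ← ENNReal.ofReal_coe_nnreal, ← ENNReal.ofReal_mul hε'.le,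
        ENNReal.ofReal_le_ofReal_iff
          (re_inner_nonneg_of_nonneg (E.op_nonneg _ hZY) ψ)] at h1
      rw [inv_mul_eq_div, le_div_iff₀ hε', mul_comm]
      exact h1.trans (re_inner_mono (E.dominates_op.mono hZY hZ Set.inter_subset_left) ψ)
  refine ⟨V, fun h => ?_, (ε : ℝ)⁻¹, by positivity, fun X hX ξ => (hV X hX ξ).trans ?_⟩
  · have := hV0 h
    rw [Set.univ_inter] at this
    rw [hν _ hY, this] at hνY
    simp at hνY
  · exact mul_le_mul_of_nonneg_left
      (re_inner_mono (hN.mono (hX.inter hY) hX Set.inter_subset_left) ξ) (by positivity)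

/-- A POVM absolutely continuous with respect to a sharp observable on a separable space has a Kraus
decomposition over it. -/
theorem exists_hasSum_of_absCont [TopologicalSpace.SeparableSpace K]
    {E : POVM Ω K} (hE : E.IsPVM) {M : POVM Ω H} (hM : M.AbsCont E) :
    ∃ 𝒱 : Set (H →L[ℂ] K), ∀ X, MeasurableSet X → ∀ ξ η,
      HasSum (fun V : 𝒱 => ⟪(V : H →L[ℂ] K) ξ, E.op X ((V : H →L[ℂ] K) η)⟫_ℂ) ⟪ξ, M.op X η⟫_ℂ := by
  classical
  let P : Set (Set (H →L[ℂ] K)) := {𝒱 | ∀ F : Finset (H →L[ℂ] K), (F : Set (H →L[ℂ] K)) ⊆ 𝒱 →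
    ∀ X, MeasurableSet X → ∀ ξ, ∑ V ∈ F, ‖E.op X (V ξ)‖ ^ 2 ≤ (⟪ξ, M.op X ξ⟫_ℂ).re}
  obtain ⟨𝒱, h𝒱⟩ := zorn_subset P fun c hc hch => by
    refine ⟨⋃₀ c, fun F hF X hX ξ => ?_, fun s hs => Set.subset_sUnion_of_mem hs⟩
    rcases c.eq_empty_or_nonempty with rfl | hne
    · have : F = ∅ := by simpa using hF
      rw [this, Finset.sum_empty]
      exact re_inner_nonneg_of_nonneg (M.op_nonneg X hX) ξ
    · obtain ⟨s, hs, hFs⟩ := hch.directedOn.exists_mem_subset_of_finite_of_subset_sUnion hne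
        F.finite_toSet hF
      exact hc hs F hFs X hX ξ
  have hP := h𝒱.prop
  have hfin : ∀ (F : Finset 𝒱) X, MeasurableSet X → ∀ ξ,
      ∑ V ∈ F, ‖E.op X ((V : H →L[ℂ] K) ξ)‖ ^ 2 ≤ (⟪ξ, M.op X ξ⟫_ℂ).re := fun F X hX ξ => by
    have := hP (F.map (Function.Embedding.subtype _)) (by simp) X hX ξ
    simpa using this
  obtain ⟨Φ, hΦ⟩ := exists_completelyPositiveMap_hasSum (fun V : 𝒱 => (V : H →L[ℂ] K))
    fun F ξ => by
      have := hfin F Set.univ .univ ξ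
      rw [E.op_univ, M.op_univ] at this
      simp only [one_apply_eq_self, inner_self_eq_norm_sq_to_K] at this
      refine this.trans (le_of_eq ?_)
      norm_cast
  have hΦre : ∀ X, MeasurableSet X → ∀ ξ,
      HasSum (fun V : 𝒱 => ‖E.op X ((V : H →L[ℂ] K) ξ)‖ ^ 2) (⟪ξ, Φ (E.op X) ξ⟫_ℂ).re :=
    fun X hX ξ => by
      simpa only [hE.re_inner_eq_norm_sq hX] using Complex.hasSum_re (hΦ (E.op X) ξ ξ)
  have hΦ0 : ∀ X, MeasurableSet X → 0 ≤ Φ (E.op X) := fun X hX => by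
    simpa using OrderHomClass.mono Φ (E.op_nonneg X hX)
  have hΦle : ∀ X, MeasurableSet X → Φ (E.op X) ≤ M.op X := fun X hX => le_iff_inner.2 fun ξ => by
    rw [inner_eq_ofReal_re (hΦ0 X hX), inner_eq_ofReal_re (M.op_nonneg X hX)]
    exact_mod_cast hasSum_le_of_sum_le (hΦre X hX ξ) fun F => hfin F X hX ξ
  have hN : M.Dominates fun X => M.op X - Φ (E.op X) :=
    Dominates.sub ⟨hΦ0, hΦle, fun s t hs ht hst => by rw [E.op_union hs ht hst, map_add]⟩
  suffices h : M.op Set.univ - Φ (E.op Set.univ) = 0 by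
    refine ⟨𝒱, fun X hX ξ η => ?_⟩
    have h1 : M.op X - Φ (E.op X) = 0 :=
      le_antisymm ((hN.mono hX .univ (Set.subset_univ X)).trans h.le) (hN.nonneg X hX)
    rw [sub_eq_zero.1 h1]
    exact hΦ (E.op X) ξ η
  by_contra hne
  obtain ⟨V, hV0, c, hc, hV⟩ := hN.exists_ne_zero_norm_sq_apply_le hE hM hne
  -- The rest of the family stays below `Φ(E)` and `tV` fits into the remainder, so maximality puts
  -- `tV` in `𝒱`. As `𝒱` is a set, this is no contradiction yet: `tV` may already be a member.
  have hmem : ∀ t : ℝ, t ^ 2 * c ≤ 1 → (t : ℂ) • V ∈ 𝒱 := fun t ht => by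
    refine h𝒱.le_of_ge (y := insert ((t : ℂ) • V) 𝒱) (fun F hF X hX ξ => ?_)
      (Set.subset_insert _ _) (Set.mem_insert _ _)
    have h1 : ∑ W ∈ F.erase ((t : ℂ) • V), ‖E.op X (W ξ)‖ ^ 2 ≤ (⟪ξ, Φ (E.op X) ξ⟫_ℂ).re := by
      have hsub : ∀ W ∈ F.erase ((t : ℂ) • V), W ∈ 𝒱 := fun W hW =>
        (hF (Finset.mem_of_mem_erase hW)).resolve_left (Finset.ne_of_mem_erase hW)
      rw [← Finset.sum_subtype_of_mem (p := (· ∈ 𝒱)) (fun W => ‖E.op X (W ξ)‖ ^ 2) hsub]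
      exact sum_le_hasSum _ (fun _ _ => sq_nonneg _) (hΦre X hX ξ)
    have h2 : ‖E.op X (((t : ℂ) • V) ξ)‖ ^ 2 ≤ (⟪ξ, (M.op X - Φ (E.op X)) ξ⟫_ℂ).re := by
      have h3 := re_inner_nonneg_of_nonneg (hN.nonneg X hX) ξ
      rw [smul_apply, map_smul, norm_smul, mul_pow, Complex.norm_real, Real.norm_eq_abs, sq_abs]
      calc t ^ 2 * ‖E.op X (V ξ)‖ ^ 2
          ≤ t ^ 2 * (c * (⟪ξ, (M.op X - Φ (E.op X)) ξ⟫_ℂ).re) :=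
            mul_le_mul_of_nonneg_left (hV X hX ξ) (sq_nonneg t)
        _ = (t ^ 2 * c) * (⟪ξ, (M.op X - Φ (E.op X)) ξ⟫_ℂ).re := by ring
        _ ≤ _ := mul_le_of_le_one_left h3 ht
    rw [sub_apply, inner_sub_right, Complex.sub_re] at h2
    calc _ ≤ ∑ W ∈ insert ((t : ℂ) • V) (F.erase ((t : ℂ) • V)), ‖E.op X (W ξ)‖ ^ 2 := by
          exact Finset.sum_le_sum_of_subset_of_nonneg (Finset.insert_erase_subset _ _)
            fun _ _ _ => sq_nonneg _
      _ = ‖E.op X (((t : ℂ) • V) ξ)‖ ^ 2 + ∑ W ∈ F.erase ((t : ℂ) • V), ‖E.op X (W ξ)‖ ^ 2 :=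
          Finset.sum_insert (by simp)
      _ ≤ _ := by linarith
  obtain ⟨ξ, hξ⟩ : ∃ ξ, V ξ ≠ 0 := by
    by_contra! h
    exact hV0 (ContinuousLinearMap.ext h)
  let δ : ℝ := (1 + c)⁻¹
  have hδ0 : 0 < δ := by positivity
  -- Infinitely many distinct scalars in `[δ/2, δ]`, with `δ²c ≤ 1`: all the `t n • V` lie in `𝒱`,
  -- and their contributions at `ξ` are bounded below, against summability.
  let t : ℕ → ℝ := fun n => δ * (2⁻¹ + 2⁻¹ * ((n : ℝ) + 1)⁻¹)
  have ht0 : ∀ n, δ * 2⁻¹ ≤ t n := fun n => by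
    dsimp only [t]; gcongr; linarith [show (0 : ℝ) ≤ 2⁻¹ * ((n : ℝ) + 1)⁻¹ by positivity]
  have ht1 : ∀ n, t n ^ 2 * c ≤ 1 := fun n => by
    have h1 : t n ≤ δ := by
      have : ((n : ℝ) + 1)⁻¹ ≤ 1 := inv_le_one_of_one_le₀ (by linarith [n.cast_nonneg (α := ℝ)])
      calc t n ≤ δ * 1 := by dsimp only [t]; gcongr; linarith
        _ = δ := mul_one _
    have h2 : 0 ≤ t n := le_trans (by positivity) (ht0 n)
    have h3 : δ * (1 + c) = 1 := inv_mul_cancel₀ (by positivity)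
    have h4 : δ ≤ 1 := inv_le_one_of_one_le₀ (by linarith)
    calc t n ^ 2 * c ≤ δ ^ 2 * c := by gcongr
      _ ≤ 1 := by nlinarith
  have htinj : Function.Injective fun n => (⟨(t n : ℂ) • V, hmem _ (ht1 n)⟩ : 𝒱) := by
    intro m n hmn
    have h1 := congrArg (fun W : 𝒱 => (W : H →L[ℂ] K)) hmn
    have h2 : (t m : ℂ) = t n := smul_left_injective ℂ hV0 h1
    have h3 : t m = t n := by exact_mod_cast h2
    have h4 := mul_left_cancel₀ hδ0.ne' h3
    simpa using h4
  have hs := ((hΦre Set.univ .univ ξ).summable.comp_injective htinj).tendsto_atTop_zero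
  have hlow : ∀ n : ℕ, (δ * 2⁻¹) ^ 2 * ‖V ξ‖ ^ 2 ≤
      ((fun W : 𝒱 => ‖E.op Set.univ ((W : H →L[ℂ] K) ξ)‖ ^ 2) ∘
        fun n => (⟨(t n : ℂ) • V, hmem _ (ht1 n)⟩ : 𝒱)) n := fun n => by
    simp only [Function.comp_apply, E.op_univ, one_apply_eq_self, smul_apply, norm_smul,
      Complex.norm_real, Real.norm_eq_abs]
    rw [← mul_pow]
    gcongr
    exact (ht0 n).trans (le_abs_self _)
  have := ge_of_tendsto' hs hlow
  have hpos : 0 < (δ * 2⁻¹) ^ 2 * ‖V ξ‖ ^ 2 := by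
    have := norm_pos_iff.2 hξ
    positivity
  exact hpos.not_ge this

end POVM

/-- Every separable Hilbert space has a copy in every universe. -/
theorem exists_linearIsometryEquiv_of_separableSpace (K : Type u) [NormedAddCommGroup K]
    [InnerProductSpace ℂ K] [CompleteSpace K] [TopologicalSpace.SeparableSpace K] :
    ∃ (K' : Type w) (_ : NormedAddCommGroup K') (_ : InnerProductSpace ℂ K')
      (_ : CompleteSpace K'), Nonempty (K ≃ₗᵢ[ℂ] K') := by
  obtain ⟨s, b, hb⟩ := exists_hilbertBasis ℂ K
  have hon := b.orthonormal
  choose g hg using fun i : s => Metric.denseRange_iff.1 (TopologicalSpace.denseRange_denseSeq K)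
    (b i) (1 / 2) (by norm_num)
  -- Distinct basis vectors are at distance `√2 > 1`, so they cannot share a `1/2`-approximant. The
  -- basis is thus indexed by a set of naturals, which lifts to any universe.
  have hinj : Function.Injective g := fun i j hij => by
    by_contra hne
    have h1 : dist (b i) (b j) < 1 := by
      have hj := hg j
      rw [← hij, dist_comm] at hj
      calc _ ≤ _ := dist_triangle _ _ _
        _ < 1 / 2 + 1 / 2 := add_lt_add (hg i) hj
        _ = 1 := by norm_num
    have h2 : ‖b i - b j‖ * ‖b i - b j‖ = 2 := by
      rw [@norm_sub_mul_self ℂ, hon.2 hne, hon.1 i, hon.1 j]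
      norm_num
    rw [dist_eq_norm] at h1
    nlinarith [norm_nonneg (b i - b j)]
  let e : s ≃ ULift.{w} (Set.range g) := (Equiv.ofInjective g hinj).trans Equiv.ulift.symm
  let b' : HilbertBasis (ULift.{w} (Set.range g)) ℂ K :=
    HilbertBasis.mk (v := b ∘ e.symm) (hon.comp _ e.symm.injective) (by
      rw [e.symm.surjective.range_comp, b.dense_span])
  exact ⟨_, _, _, inferInstance, ⟨b'.repr⟩⟩

/-! ### Pre-processings, compressions and the spectral measure on `L²`. -/

namespace POVM

open ContinuousLinearMap MeasureTheory

variable {Ω : Type v} [MeasurableSpace Ω]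
  {H : Type u} [NormedAddCommGroup H] [InnerProductSpace ℂ H] [CompleteSpace H]
  {H' : Type w} [NormedAddCommGroup H'] [InnerProductSpace ℂ H'] [CompleteSpace H']

theorem op_le_one (M : POVM Ω H) {X : Set Ω} (hX : MeasurableSet X) : M.op X ≤ 1 :=
  M.dominates_op.le_one hX

/-- The case `X = Ω` reads `∑ ‖V i ξ‖² = ‖ξ‖²`, which supplies both the row contraction bound and
unitality. -/
theorem preLE_of_hasSum {M' : POVM Ω H'} {M : POVM Ω H} {ι : Type*} (V : ι → H' →L[ℂ] H)
    (h : ∀ X, MeasurableSet X → ∀ ξ η,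
      HasSum (fun i => ⟪V i ξ, M.op X (V i η)⟫_ℂ) ⟪ξ, M'.op X η⟫_ℂ) : M'.PreLE M := by
  obtain ⟨Φ, hΦ⟩ := exists_completelyPositiveMap_hasSum V fun F ξ => by
    have h1 := Complex.hasSum_re (h Set.univ .univ ξ ξ)
    simp only [M.op_univ, M'.op_univ, one_apply_eq_self, inner_self_eq_norm_sq_to_K] at h1
    have e : ∀ r : ℝ, ((r : ℂ) ^ 2).re = r ^ 2 := fun r => by norm_cast
    simp only [Complex.coe_algebraMap, e] at h1
    exact sum_le_hasSum F (fun _ _ => sq_nonneg _) h1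
  have hΦM : ∀ X, MeasurableSet X → M'.op X = Φ (M.op X) := fun X hX =>
    ContinuousLinearMap.ext fun η => ext_inner_left ℂ fun ξ => (h X hX ξ η).unique (hΦ _ ξ η)
  refine ⟨Φ, ⟨?_, fun S hne _ hdir a ha => isLUB_image_of_hasSum hΦ hne hdir ha⟩, hΦM⟩
  rw [← M.op_univ, ← hΦM _ .univ, M'.op_univ]

theorem AbsCont.preLE [TopologicalSpace.SeparableSpace H] {E : POVM Ω H} (hE : E.IsPVM)
    {M : POVM Ω H'} (hM : M.AbsCont E) : M.PreLE E := by
  obtain ⟨𝒱, h𝒱⟩ := exists_hasSum_of_absCont hE hM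
  exact preLE_of_hasSum _ h𝒱

/-- The compression of a POVM to a closed subspace. -/
noncomputable def compress (M : POVM Ω H) (𝓜 : Submodule ℂ H) [CompleteSpace 𝓜] : POVM Ω 𝓜 where
  op X := 𝓜.orthogonalProjectionOnto ∘L M.op X ∘L 𝓜.subtypeL
  op_not_measurable X hX := by rw [M.op_not_measurable X hX]; simp
  op_nonneg X hX := nonneg_iff_inner.2 fun x => by
    have := nonneg_iff_inner.1 (M.op_nonneg X hX) (x : H)
    simpa using this
  op_univ := by
    ext x
    simp [M.op_univ]
  op_iUnion X hX hd φ ψ := by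
    simpa using M.op_iUnion X hX hd φ ψ

theorem inner_compress_op (M : POVM Ω H) (𝓜 : Submodule ℂ H) [CompleteSpace 𝓜] (X : Set Ω)
    (x y : 𝓜) : ⟪x, (M.compress 𝓜).op X y⟫_ℂ = ⟪(x : H), M.op X y⟫_ℂ := by
  simp [compress]

/-- Transport of a POVM along a unitary. -/
noncomputable def transport (M : POVM Ω H) (U : H ≃ₗᵢ[ℂ] H') : POVM Ω H' where
  op X := U.conjStarAlgEquiv (M.op X)
  op_not_measurable X hX := by rw [M.op_not_measurable X hX, map_zero]
  op_nonneg X hX := map_nonneg _ (M.op_nonneg X hX)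
  op_univ := by rw [M.op_univ, map_one]
  op_iUnion X hX hd φ ψ := by
    have h : ∀ A : H →L[ℂ] H, ⟪φ, U.conjStarAlgEquiv A ψ⟫_ℂ = ⟪U.symm φ, A (U.symm ψ)⟫_ℂ :=
      fun A => by
        rw [← U.inner_map_map (U.symm φ)]
        simp
    simpa only [h] using M.op_iUnion X hX hd (U.symm φ) (U.symm ψ)

theorem transport_op_eq_zero_iff (M : POVM Ω H) (U : H ≃ₗᵢ[ℂ] H') (X : Set Ω) :
    (M.transport U).op X = 0 ↔ M.op X = 0 :=
  map_eq_zero_iff _ U.conjStarAlgEquiv.injective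

theorem IsPVM.transport {M : POVM Ω H} (hM : M.IsPVM) (U : H ≃ₗᵢ[ℂ] H') :
    (M.transport U).IsPVM := fun X hX => (hM X hX).map U.conjStarAlgEquiv

/-- A POVM on a separable space has the same null sets as some finite measure. -/
theorem exists_measure_eq_zero_iff [TopologicalSpace.SeparableSpace H] (M : POVM Ω H) :
    ∃ μ : Measure Ω, IsFiniteMeasure μ ∧ ∀ X, MeasurableSet X → (μ X = 0 ↔ M.op X = 0) := by
  choose μ hμf hμ using fun n => M.dominates_op.exists_measure (TopologicalSpace.denseSeq H n)
  have key : ∀ X, MeasurableSet X → ((Measure.sum μ) X = 0 ↔ M.op X = 0) := fun X hX => by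
    rw [Measure.sum_apply_eq_zero' hX]
    constructor
    · intro h
      refine DFunLike.coe_injective <| Continuous.ext_on (TopologicalSpace.denseRange_denseSeq H)
        (M.op X).continuous (0 : H →L[ℂ] H).continuous ?_
      rintro _ ⟨n, rfl⟩
      have h1 := h n
      rw [hμ _ _ hX, ENNReal.ofReal_eq_zero] at h1
      have h2 := re_inner_nonneg_of_nonneg (M.op_nonneg X hX) (TopologicalSpace.denseSeq H n)
      refine apply_eq_zero_of_inner_eq_zero (M.op_nonneg X hX) ?_
      rw [inner_eq_ofReal_re (M.op_nonneg X hX), le_antisymm h1 h2, Complex.ofReal_zero]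
    · intro h n
      rw [hμ _ _ hX, h]; simp
  -- The sum over a dense sequence need not be finite; `toFinite` keeps its null sets.
  refine ⟨(Measure.sum μ).toFinite, inferInstance, fun X hX => ?_⟩
  rw [← key X hX]
  exact ⟨fun h => absolutelyContinuous_toFinite _ h, fun h => toFinite_absolutelyContinuous _ h⟩

/-- Restriction of square-integrable functions to a measurable set. -/
noncomputable def indicatorL2 (μ : Measure Ω) {s : Set Ω} (hs : MeasurableSet s) :
    Lp ℂ 2 μ →L[ℂ] Lp ℂ 2 μ :=
  LinearMap.mkContinuous
    { toFun := fun f => ((Lp.memLp f).indicator hs).toLp _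
      map_add' := fun f g => by
        rw [← MemLp.toLp_add]
        refine MemLp.toLp_congr _ _ ?_
        filter_upwards [Lp.coeFn_add f g] with x hx
        by_cases h : x ∈ s
        · simpa only [Pi.add_apply, Set.indicator_of_mem h] using hx
        · simp [h]
      map_smul' := fun c f => by
        rw [RingHom.id_apply, ← MemLp.toLp_const_smul]
        refine MemLp.toLp_congr _ _ ?_
        filter_upwards [Lp.coeFn_smul c f] with x hx
        by_cases h : x ∈ s
        · simpa only [Pi.smul_apply, Set.indicator_of_mem h] using hx
        · simp [h] } 1 fun f => by
    rw [one_mul]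
    refine Lp.norm_le_norm_of_ae_le ?_
    filter_upwards [((Lp.memLp f).indicator hs).coeFn_toLp] with x hx
    exact hx ▸ norm_indicator_le_norm_self _ _

theorem coeFn_indicatorL2 (μ : Measure Ω) {s : Set Ω} (hs : MeasurableSet s) (f : Lp ℂ 2 μ) :
    indicatorL2 μ hs f =ᵐ[μ] s.indicator f :=
  ((Lp.memLp f).indicator hs).coeFn_toLp

theorem inner_indicatorL2 (μ : Measure Ω) {s : Set Ω} (hs : MeasurableSet s) (f g : Lp ℂ 2 μ) :
    ⟪f, indicatorL2 μ hs g⟫_ℂ = ∫ x in s, ⟪f x, g x⟫_ℂ ∂μ := by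
  rw [L2.inner_def, ← integral_indicator hs]
  refine integral_congr_ae ?_
  filter_upwards [coeFn_indicatorL2 μ hs g] with x hx
  rw [hx]
  by_cases h : x ∈ s <;> simp [h]

theorem isStarProjection_indicatorL2 (μ : Measure Ω) {s : Set Ω} (hs : MeasurableSet s) :
    IsStarProjection (indicatorL2 μ hs) := by
  refine ⟨ContinuousLinearMap.ext fun f => Lp.ext ?_, ?_⟩
  · rw [mul_apply_eq_comp]
    filter_upwards [coeFn_indicatorL2 μ hs (indicatorL2 μ hs f), coeFn_indicatorL2 μ hs f]
      with x h1 h2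
    rw [h1, h2]
    by_cases h : x ∈ s <;> simp [h, h2]
  · rw [isSelfAdjoint_iff_isSymmetric]
    intro f g
    simp only [ContinuousLinearMap.coe_coe]
    rw [← inner_conj_symm, inner_indicatorL2, inner_indicatorL2, ← integral_conj]
    simp [mul_comm]

open Classical in
/-- The canonical spectral measure on `L²(μ)`. -/
noncomputable def spectral (μ : Measure Ω) : POVM Ω (Lp ℂ 2 μ) where
  op X := if h : MeasurableSet X then indicatorL2 μ h else 0
  op_not_measurable X hX := dif_neg hX
  op_nonneg X hX := by
    rw [dif_pos hX]
    exact (isStarProjection_indicatorL2 μ hX).nonneg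
  op_univ := by
    rw [dif_pos .univ]
    refine ContinuousLinearMap.ext fun f => Lp.ext ?_
    filter_upwards [coeFn_indicatorL2 μ .univ f] with x h
    rw [h]; simp
  op_iUnion X hX hd φ ψ := by
    simp only [dif_pos (hX _), dif_pos (MeasurableSet.iUnion hX), inner_indicatorL2]
    exact hasSum_integral_iUnion hX hd (L2.integrable_inner φ ψ).integrableOn

theorem spectral_op (μ : Measure Ω) {X : Set Ω} (hX : MeasurableSet X) :
    (spectral μ).op X = indicatorL2 μ hX := dif_pos hX

theorem isPVM_spectral (μ : Measure Ω) : (spectral μ).IsPVM := fun X hX => by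
  rw [spectral_op μ hX]
  exact isStarProjection_indicatorL2 μ hX

theorem spectral_op_eq_zero_iff (μ : Measure Ω) [IsFiniteMeasure μ] {X : Set Ω}
    (hX : MeasurableSet X) : (spectral μ).op X = 0 ↔ μ X = 0 := by
  rw [spectral_op μ hX]
  constructor
  · intro h
    have h1 := coeFn_indicatorL2 μ hX ((memLp_const (1 : ℂ)).toLp _)
    rw [h, zero_apply] at h1
    have : ∀ᵐ x ∂μ, x ∉ X := by
      filter_upwards [h1, Lp.coeFn_zero ℂ 2 μ, (memLp_const (μ := μ) (p := 2) (1 : ℂ)).coeFn_toLp]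
        with x h2 h3 h4 h5
      rw [h3, Set.indicator_of_mem h5, h4] at h2
      simp at h2
    simpa [ae_iff] using this
  · intro h
    refine ContinuousLinearMap.ext fun f => Lp.ext ?_
    have : ∀ᵐ x ∂μ, x ∉ X := by simpa [ae_iff] using h
    rw [zero_apply]
    filter_upwards [coeFn_indicatorL2 μ hX f, this, Lp.coeFn_zero ℂ 2 μ] with x h1 h2 h3
    rw [h1, h3, Set.indicator_of_notMem h2]; rfl

/-- Every POVM on a separable space over a countably generated σ-algebra is equivalent to a sharp
observable on a separable space in any given universe. -/
theorem exists_isPVM_equivalent [MeasurableSpace.CountablyGenerated Ω]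
    [TopologicalSpace.SeparableSpace H] (M : POVM Ω H) :
    ∃ (K : Type w) (_ : NormedAddCommGroup K) (_ : InnerProductSpace ℂ K) (_ : CompleteSpace K)
      (_ : TopologicalSpace.SeparableSpace K) (E : POVM Ω K), E.IsPVM ∧ E.Equivalent M := by
  obtain ⟨μ, hμf, hμ⟩ := M.exists_measure_eq_zero_iff
  -- Together with countable generation, this yields separability of `L²(μ)`.
  have : Fact ((2 : ENNReal) ≠ ⊤) := ⟨by simp⟩
  obtain ⟨K, i1, i2, i3, ⟨U⟩⟩ := exists_linearIsometryEquiv_of_separableSpace.{v, w} (Lp ℂ 2 μ)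
  have hsep : TopologicalSpace.SeparableSpace K :=
    U.surjective.denseRange.separableSpace U.continuous
  have h : ∀ X, MeasurableSet X → (((spectral μ).transport U).op X = 0 ↔ M.op X = 0) :=
    fun X hX => by rw [transport_op_eq_zero_iff, spectral_op_eq_zero_iff μ hX, hμ X hX]
  exact ⟨K, i1, i2, i3, hsep, (spectral μ).transport U, (isPVM_spectral μ).transport U,
    fun X hX => (h X hX).2, fun X hX => (h X hX).1⟩

end POVM

/-! ### The sharp subspace and the two implications. -/

namespace POVM

open ContinuousLinearMap

variable {Ω : Type v} [MeasurableSpace Ω]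
  {H : Type u} [NormedAddCommGroup H] [InnerProductSpace ℂ H] [CompleteSpace H]

/-- The largest subspace on which the POVM is sharp. -/
def sharpSubspace (M : POVM Ω H) : Submodule ℂ H :=
  ⨅ (X : Set Ω) (_ : MeasurableSet X), (M.op X * M.op X - M.op X).ker

theorem mem_sharpSubspace {M : POVM Ω H} {u : H} :
    u ∈ M.sharpSubspace ↔ ∀ X, MeasurableSet X → M.op X (M.op X u) = M.op X u := by
  simp [sharpSubspace, sub_eq_zero]

theorem isClosed_sharpSubspace (M : POVM Ω H) : IsClosed (M.sharpSubspace : Set H) := by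
  simp only [sharpSubspace, Submodule.coe_iInf]
  exact isClosed_iInter fun X => isClosed_iInter fun _ => (M.op X * M.op X - M.op X).isClosed_ker

theorem op_compl (M : POVM Ω H) {X : Set Ω} (hX : MeasurableSet X) :
    M.op Xᶜ = 1 - M.op X := by
  rw [eq_sub_iff_add_eq', ← M.op_union hX hX.compl disjoint_compl_right, Set.union_compl_self,
    M.op_univ]

theorem op_apply_eq_self_of_subset (M : POVM Ω H) {X Y : Set Ω} (hX : MeasurableSet X)
    (hY : MeasurableSet Y) (hXY : X ⊆ Y) {u : H} (hu : M.op X u = u) : M.op Y u = u := by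
  have h1 : 0 ≤ 1 - M.op Y := sub_nonneg.2 (M.op_le_one hY)
  have h2 := le_iff_inner.1 (sub_le_sub_left (M.dominates_op.mono hX hY hXY) 1) u
  have h3 : (1 - M.op Y) u = 0 := by
    refine apply_eq_zero_of_inner_eq_zero h1 (le_antisymm (h2.trans ?_) (nonneg_iff_inner.1 h1 u))
    simp [hu]
  rw [sub_apply, one_apply_eq_self, sub_eq_zero] at h3
  exact h3.symm

theorem op_apply_eq_zero_of_disjoint (M : POVM Ω H) {X Y : Set Ω} (hX : MeasurableSet X)
    (hY : MeasurableSet Y) (hXY : Disjoint X Y) {u : H} (hu : M.op X u = u) : M.op Y u = 0 := by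
  have := M.op_apply_eq_self_of_subset hX hY.compl hXY.subset_compl_right hu
  rw [M.op_compl hY] at this
  simpa using this

/-- `M(Z)u` is fixed by `M(Z)`, hence fixed by `M(X)` for `X ⊇ Z` and killed by it for `X` disjoint
from `Z`. Split `Y` along `X`. -/
theorem op_op_apply_of_mem_sharpSubspace {M : POVM Ω H} {u : H} (hu : u ∈ M.sharpSubspace)
    {X Y : Set Ω} (hX : MeasurableSet X) (hY : MeasurableSet Y) :
    M.op X (M.op Y u) = M.op (X ∩ Y) u := by
  rw [mem_sharpSubspace] at hu
  have e : M.op Y u = M.op (X ∩ Y) u + M.op (Y \ X) u := by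
    rw [← add_apply, ← M.op_union (hX.inter hY) (hY.diff hX), Set.inter_comm,
      Set.inter_union_sdiff]
    rw [Set.inter_comm]
    exact Set.disjoint_sdiff_inter.symm
  rw [e, map_add,
    M.op_apply_eq_self_of_subset (hX.inter hY) hX Set.inter_subset_left (hu _ (hX.inter hY)),
    M.op_apply_eq_zero_of_disjoint (hY.diff hX) hX Set.disjoint_sdiff_left (hu _ (hY.diff hX)),
    add_zero]

theorem op_apply_mem_sharpSubspace {M : POVM Ω H} {u : H} (hu : u ∈ M.sharpSubspace)
    {Y : Set Ω} (hY : MeasurableSet Y) : M.op Y u ∈ M.sharpSubspace := by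
  refine mem_sharpSubspace.2 fun X hX => ?_
  rw [op_op_apply_of_mem_sharpSubspace hu hX hY,
    op_op_apply_of_mem_sharpSubspace hu hX (hX.inter hY), ← Set.inter_assoc, Set.inter_self]

theorem isSymmetric_op (M : POVM Ω H) {X : Set Ω} (hX : MeasurableSet X) (x y : H) :
    ⟪M.op X x, y⟫_ℂ = ⟪x, M.op X y⟫_ℂ :=
  (IsSelfAdjoint.of_nonneg (M.op_nonneg X hX)).isSymmetric x y

theorem coe_compress_op {M : POVM Ω H} {𝓜 : Submodule ℂ H} [CompleteSpace 𝓜] {X : Set Ω} {u : 𝓜}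
    (h : M.op X u ∈ 𝓜) : ((M.compress 𝓜).op X u : H) = M.op X u :=
  congrArg Subtype.val (Submodule.orthogonalProjectionOnto_mem_subspace_eq_self
    (⟨M.op X u, h⟩ : 𝓜))

/-- A POVM leaving a closed subspace invariant is the orthogonal sum of its compressions. -/
theorem op_eq_orthogonalSum (M : POVM Ω H) (𝓜 : Submodule ℂ H) [CompleteSpace 𝓜] {X : Set Ω}
    (hX : MeasurableSet X) (h : ∀ u ∈ 𝓜, M.op X u ∈ 𝓜) :
    M.op X = orthogonalSum 𝓜 ((M.compress 𝓜).op X) ((M.compress 𝓜ᗮ).op X) := by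
  have h' : ∀ u ∈ 𝓜ᗮ, M.op X u ∈ 𝓜ᗮ := fun u hu => (Submodule.mem_orthogonal _ _).2 fun w hw => by
    rw [← M.isSymmetric_op hX]
    exact (Submodule.mem_orthogonal _ _).1 hu _ (h w hw)
  refine ContinuousLinearMap.ext fun u => ?_
  simp only [orthogonalSum, add_apply, comp_apply, Submodule.subtypeL_apply]
  rw [coe_compress_op (h _ (Submodule.coe_mem _)), coe_compress_op (h' _ (Submodule.coe_mem _)),
    ← map_add]
  congr 1
  exact (𝓜.starProjection_add_starProjection_orthogonal u).symm

theorem isPVM_compress_sharpSubspace (M : POVM Ω H) [CompleteSpace M.sharpSubspace] :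
    (M.compress M.sharpSubspace).IsPVM := by
  intro X hX
  refine ⟨ContinuousLinearMap.ext fun u => ext_inner_left ℂ fun w => ?_,
    .of_nonneg ((M.compress _).op_nonneg X hX)⟩
  rw [mul_apply_eq_comp, inner_compress_op, inner_compress_op,
    coe_compress_op (op_apply_mem_sharpSubspace u.2 hX),
    mem_sharpSubspace.1 u.2 X hX]

/-- If a sharp observable is a pre-processing of `M`, then it is null on the sets on which the sharp
part of `M` vanishes. -/
theorem PreLE.op_eq_zero_of_sharpSubspace {H' : Type w} [NormedAddCommGroup H']
    [InnerProductSpace ℂ H'] [CompleteSpace H'] {E : POVM Ω H'} (hE : E.IsPVM) {M : POVM Ω H}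
    (h : E.PreLE M) {X : Set Ω} (hX : MeasurableSet X)
    (h0 : ∀ u ∈ M.sharpSubspace, M.op X u = 0) : E.op X = 0 := by
  obtain ⟨Φ, hΦ, hEM⟩ := h
  rw [hEM X hX]
  refine hΦ.map_eq_zero_of_forall_apply_eq_zero (M.op_nonneg X hX) (M.op_le_one hX) fun u hu =>
    h0 u (mem_sharpSubspace.2 fun Z hZ => ?_)
  have hsa : IsSelfAdjoint (M.op Z) := .of_nonneg (M.op_nonneg Z hZ)
  have ha : 0 ≤ M.op Z - M.op Z * M.op Z := by
    have := CStarAlgebra.pow_antitone (M.op_nonneg Z hZ) (M.op_le_one hZ) one_le_two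
    simpa [sq] using this
  -- Sharpness of `E` turns the Schwarz inequality into `Φ(M(Z)) = Φ(M(Z))² ≤ Φ(M(Z)²)`.
  have hΦa : Φ (M.op Z - M.op Z * M.op Z) = 0 := by
    refine le_antisymm ?_ (by simpa using OrderHomClass.mono Φ ha)
    have h1 := Φ.map_mul_self_le hΦ.unital hsa (by rw [← hEM Z hZ]; exact (hE Z hZ).isSelfAdjoint)
    rw [← hEM Z hZ, (hE Z hZ).isIdempotentElem.eq] at h1
    rw [map_sub, ← hEM Z hZ]
    exact sub_nonpos.2 h1
  have := hu _ ha hΦa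
  rw [sub_apply, sub_eq_zero, mul_apply_eq_comp] at this
  exact this.symm

theorem isPreProcessingClean_of_orthogonalSum [TopologicalSpace.SeparableSpace H] {M : POVM Ω H}
    (𝓜 : Submodule ℂ H) [CompleteSpace 𝓜] (E : POVM Ω 𝓜) (F : POVM Ω 𝓜ᗮ) (hE : E.IsPVM)
    (hME : M.Equivalent E)
    (h : ∀ X, MeasurableSet X → M.op X = orthogonalSum 𝓜 (E.op X) (F.op X)) :
    IsPreProcessingClean.{u, v, w} M := by
  intro H' _ _ _ M' hM' _
  have hac : M'.AbsCont E := fun X hX hEX => hM'.1 X hX (hME.1 X hX hEX)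
  obtain ⟨𝒱, h𝒱⟩ := exists_hasSum_of_absCont hE hac
  refine preLE_of_hasSum (fun V : 𝒱 => 𝓜.subtypeL ∘L (V : H' →L[ℂ] 𝓜)) fun X hX ξ η => ?_
  -- On `𝓜` the summand `F` drops out, so Kraus operators over `E` serve for `M` after inclusion.
  have e : ∀ x : 𝓜, M.op X x = E.op X x := fun x => by
    rw [h X hX]
    simp [orthogonalSum, Submodule.orthogonalProjectionOnto_orthogonal_apply_eq_zero x.2]
  simpa [e] using h𝒱 X hX ξ η

theorem IsPreProcessingClean.equivalent_compress_sharpSubspace [MeasurableSpace.CountablyGenerated Ω]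
    [TopologicalSpace.SeparableSpace H] {M : POVM Ω H}
    (hM : IsPreProcessingClean.{u, v, w} M) [CompleteSpace M.sharpSubspace] :
    M.Equivalent (M.compress M.sharpSubspace) := by
  obtain ⟨K, i1, i2, i3, i4, E, hE, hEM⟩ := exists_isPVM_equivalent.{u, v, w} M
  have h1 : E.PreLE M := hM K E hEM (AbsCont.preLE hE hEM.2)
  refine ⟨fun X hX h => hEM.2 X hX (h1.op_eq_zero_of_sharpSubspace hE hX fun u hu => ?_),
    fun X hX h => ?_⟩
  · rw [← coe_compress_op (u := ⟨u, hu⟩) (op_apply_mem_sharpSubspace hu hX), h]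
    simp
  · simp [compress, h]

end POVM

end

theorem mainTheorem5 {Ω : Type v} [MeasurableSpace Ω] [MeasurableSpace.CountablyGenerated Ω]
    {H : Type u} [NormedAddCommGroup H] [InnerProductSpace ℂ H] [CompleteSpace H]
    [TopologicalSpace.SeparableSpace H] (M : POVM Ω H) :
    POVM.IsPreProcessingClean.{u, v, w} M ↔
      ∃ (𝓜 : Submodule ℂ H) (h𝓜 : IsClosed (𝓜 : Set H)),
        haveI : CompleteSpace 𝓜 := h𝓜.completeSpace_coe
        ∃ (E : POVM Ω 𝓜) (F : POVM Ω 𝓜ᗮ), E.IsPVM ∧ M.Equivalent E ∧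
          ∀ X : Set Ω, MeasurableSet X → M.op X = orthogonalSum 𝓜 (E.op X) (F.op X) := by
  constructor
  · intro hM
    have : CompleteSpace M.sharpSubspace := M.isClosed_sharpSubspace.completeSpace_coe
    exact ⟨M.sharpSubspace, M.isClosed_sharpSubspace, M.compress _, M.compress _,
      M.isPVM_compress_sharpSubspace, hM.equivalent_compress_sharpSubspace, fun X hX =>
        M.op_eq_orthogonalSum _ hX fun u hu => POVM.op_apply_mem_sharpSubspace hu hX⟩
  · rintro ⟨𝓜, h𝓜, E, F, hE, hME, h⟩
    have : CompleteSpace 𝓜 := h𝓜.completeSpace_coe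
    exact POVM.isPreProcessingClean_of_orthogonalSum 𝓜 E F hE hME h
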